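/- **Time warps.** A time warp is a sup-preserving map $p:\omega+1\to\omega+1$, where $\omega+1=\{0,1,2,\dots,\omega\}$; time warps are ordered pointwise, and binary infima and suprema are pointwise. Write $p\ast q = q\circ p$; $\underline{id}$ is the identity, $\underline{-1}(n)=n-1$ and $\underline{\omega}(n)=\omega$ for $0<n<\omega$. Let $q\backslash p$ be the greatest time warp $r$ with $r\circ p\le q$. **Types.** Fix a set $G$ of ground types and pairwise disjoint sets of scalars $(S_\nu)_{\nu\in G}$. Types are $\tau ::= \nu \mid \mathsf{S}\,\tau\mid \tau\to\tau\mid\tau\times\tau\mid\tau+\tau\mid \ast_p\tau$. A context $\Gamma$ is a finite list of bindings $x:\tau$ with distinct variables; operations on types are extended pointwise to contexts. **Coercions.** The judgment $\alpha:\tau<:\tau'$ is generated by: $\mathsf{id}:\tau<:\tau$; composition $\alpha_1;\alpha_2$; congruences $\mathsf{S}\,\alpha$, $\alpha_1\to\alpha_2$ (contravariant on the left), $\alpha_1\times\alpha_2$, $\alpha_1+\alpha_2$, $\ast_p\alpha$; $\mathsf{wrap}:\tau<:\ast_{\underline{id}}\tau$ and $\mathsf{unwrap}$ backwards; $\mathsf{concat}^{p,q}:\ast_p\ast_q\tau<:\ast_{p\ast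 q}\tau$ and $\mathsf{decat}^{p,q}$ backwards; $\mathsf{inflate}:\nu<:\ast_{\underline\omega}\nu$; $\mathsf{dist}:\ast_p(\tau_1\times\tau_2)<:\ast_p\tau_1\times\ast_p\tau_2$ and $\mathsf{fact}$ backwards; $\mathsf{delay}^{p,q}:\ast_p\tau<:\ast_q\tau$ when $q\le p$. A context coercion $\beta:\Gamma<:\Gamma'$, for contexts with the same variables, gives a coercion $\beta(x):\Gamma(x)<:\Gamma'(x)$ for each variable $x$. **Explicit terms** (up to renaming of bound variables) and the judgment $\Gamma\vdash e:\tau$. Variables, $\mathsf{fun}(x{:}\tau).e$, applications, pairs, projections, injections $\mathsf{inj}_1^{\tau_2}e$, $\mathsf{inj}_2^{\tau_1}e$ annotated with the other summand, case analysis and scalars are typed as in simply typed $\lambda$-calculus. Moreover: - $\mathsf{head}\,e:\tau$ and $\mathsf{tail}\,e:\ast_{\underline{-1}}\mathsf{S}\tau$ if $e:\mathsf{S}\tau$; $e_1::e_2:\mathsf{S}\tau$ if $e_1:\tau$ and $e_2:\ast_{\underline{-1}}\mathsf{S}\tau$; - $\Gamma\vdash\mathsf{rec}(x{:}\tau).e:\tau$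 if $\Gamma,x:\ast_{\underline{-1}}\tau\vdash e:\tau$; - $\ast_p\Gamma\vdash e\,\mathsf{by}\,p:\ast_p\tau$ if $\Gamma\vdash e:\tau$; - $\Gamma\vdash e;\alpha:\tau'$ if $\Gamma\vdash e:\tau$ and $\alpha:\tau<:\tau'$; - $\Gamma\vdash\beta;e:\tau$ if $\beta:\Gamma<:\Gamma'$ and $\Gamma'\vdash e:\tau$; - $\Gamma'\vdash\sigma[e]:\tau$ if $\Gamma\vdash e:\tau$ and $\sigma$ maps the variables of $\Gamma$ to those of $\Gamma'$ with $\Gamma'(\sigma(x))=\Gamma(x)$. Here $\sigma[e]$ substitutes $\sigma(x)$ for $x$. So that this always makes sense, a node $\beta;e$ binds the variables of $e$ and records from which outer variable $\rho(x)$ each such $x$ is read (before being coerced by $\beta(x)$): $\rho=\mathrm{id}$ in the typing rule, and $\sigma$ acts by $\rho\mapsto\sigma\circ\rho$. The erasure $|e|$ removes all coercions: $|e;\alpha|=|e|$, $|\beta;e|=\rho[|e|]$. An implicit term is one without coercions. **Algorithmic subtyping.** The normal form of a type is given by $\overline\nu=\ast_{\underline\omega}\nu$, $\overline{\mathsf{S}\tau}=\ast_{\underline{id}}\mathsf{S}\overline\tau$,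 $\overline{\tau_1\to\tau_2}=\ast_{\underline{id}}(\overline{\tau_1}\to\overline{\tau_2})$, $\overline{\tau_1+\tau_2}=\ast_{\underline{id}}(\overline{\tau_1}+\overline{\tau_2})$, $\overline{\tau_1\times\tau_2}=\overline{\tau_1}\times\overline{\tau_2}$, and $\overline{\ast_p\tau}=P_p(\overline\tau)$, where $P_p(\tau_1\times\tau_2)=P_p(\tau_1)\times P_p(\tau_2)$ and $P_p(\ast_q\tau)=\ast_{p\ast q}\tau$. The evident coercions $\mathsf{in}_\tau:\tau<:\overline\tau$ and $\mathsf{out}_\tau:\overline\tau<:\tau$ are defined by recursion from $\mathsf{inflate}$, $\mathsf{wrap}$, $\mathsf{concat}$, $\mathsf{dist}$ and their inverses (the inverse of $\mathsf{inflate}$ being $\mathsf{delay}^{\underline\omega,\underline{id}};\mathsf{unwrap}$). The partial function $\mathrm{Prec}(\tau,\tau')$ traverses both types in lockstep (contravariantly on the left of arrows), with $\mathrm{Prec}(\nu,\nu)=\mathsf{id}$ and $\mathrm{Prec}(\ast_p\tau,\ast_q\tau')=\mathsf{delay}^{p,q};\ast_q\mathrm{Prec}(\tau,\tau')$ if $q\le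 p$. Put $\mathrm{Coe}(\tau,\tau')=\mathsf{in}_\tau;\mathrm{Prec}(\overline\tau,\overline{\tau'});\mathsf{out}_{\tau'}$. Division $\tau\backslash p$ replaces each outermost warp $\ast_q$ of the normal form $\overline\tau$ (below products) by $\ast_{q\backslash p}$. The partial supremum $\tau\sqcup\tau'$ is computed on $\overline\tau,\overline{\tau'}$ in lockstep, taking infima of warps in covariant and suprema in contravariant positions. **Elaboration.** The partial function $\mathrm{Elab}(\Gamma,t)$, for implicit $t$, returns a type and an explicit term; primed and indexed data come from $\mathrm{Elab}(\Gamma,t)=(\tau,e)$, $\mathrm{Elab}(\Gamma,t_i)=(\tau_i,e_i)$ unless said otherwise, and it is undefined when a stated condition fails. - $x\mapsto(\Gamma(x),x)$; $s\mapsto(\nu,s)$ for $s\in S_\nu$; $(t_1,t_2)\mapsto(\tau_1\times\tau_2,(e_1,e_2))$; $\mathsf{inj}_1^{\tau_2}t\mapsto(\tau+\tau_2,\mathsf{inj}_1^{\tau_2}e)$, and symmetrically for $\mathsf{inj}_2$. - $\mathsf{fun}(x{:}\sigma).t\mapsto(\sigma\to\tau',\mathsf{fun}(x{:}\sigma).e)$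 with $(\tau',e)=\mathrm{Elab}((\Gamma,x{:}\sigma),t)$. - $t_1\,t_2\mapsto(\tau_1'',(e_1;\mathrm{Coe}(\tau_1,\tau_1'\to\tau_1''))\,(e_2;\mathrm{Coe}(\tau_2,\tau_1')))$ with $\overline{\tau_1}=\ast_q(\tau_1'\to\tau_1'')$. - $\mathsf{proj}_i t\mapsto(\sigma_i,\mathsf{proj}_i(e;\mathrm{Coe}(\tau,\sigma_1\times\sigma_2)))$ with $\overline\tau=\sigma_1\times\sigma_2$. - $\mathsf{case}\,t\,\{x_1.t_1\mid x_2.t_2\}\mapsto(\kappa,\mathsf{case}\,(e;\mathrm{Coe}(\tau,\sigma_1+\sigma_2))\{x_i.\,e_i;\mathrm{Coe}(\tau_i',\kappa)\})$ with $\overline\tau=\ast_q(\sigma_1+\sigma_2)$, $(\tau_i',e_i)=\mathrm{Elab}((\Gamma,x_i{:}\sigma_i),t_i)$, $\kappa=\tau_1'\sqcup\tau_2'$. - $\mathsf{head}\,t\mapsto(\sigma,\mathsf{head}(e;\mathrm{Coe}(\tau,\mathsf{S}\sigma)))$ and $\mathsf{tail}\,t\mapsto(\ast_{\underline{-1}}\mathsf{S}\sigma,\mathsf{tail}(e;\mathrm{Coe}(\tau,\mathsf{S}\sigma)))$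 with $\overline\tau=\ast_q\mathsf{S}\sigma$. - $t_1::t_2\mapsto(\mathsf{S}\kappa,(e_1;\mathrm{Coe}(\tau_1,\kappa))::(e_2;\mathrm{Coe}(\tau_2,\ast_{\underline{-1}}\mathsf{S}\kappa)))$ with $\overline{\tau_2}=\ast_q\mathsf{S}\tau_2'$, $\kappa=\tau_1\sqcup\tau_2'$. - $\mathsf{rec}(x{:}\sigma).t\mapsto(\sigma,\mathsf{rec}(x{:}\sigma).(e;\mathrm{Coe}(\tau',\sigma)))$ with $(\tau',e)=\mathrm{Elab}((\Gamma,x{:}\ast_{\underline{-1}}\sigma),t)$. - $t\,\mathsf{by}\,p\mapsto(\ast_p\tau',\mathrm{Coe}(\Gamma,\ast_p(\Gamma\backslash p));(e\,\mathsf{by}\,p))$ with $(\tau',e)=\mathrm{Elab}(\Gamma\backslash p,t)$. **Semantics.** The topos of trees is the category of presheaves on $\omega=\{1,2,\dots\}$. Ground types denote constant presheaves $S_\nu$, products, sums and functions the cartesian closed structure, $[\![\mathsf{S}\tau]\!](n)=\prod_{1\le m\le n}[\![\tau]\!](m)$ (so $[\![\mathsf{S}\tau]\!](n)=[\![\tau]\!](n)\times[\![\mathsf{S}\tau]\!](n-1)$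 for $n>1$, head and tail), and $[\![\ast_p\tau]\!](n)$ is the set of families $(x_m)\in\prod_{1\le m\le p(n),\,m<\omega}[\![\tau]\!](m)$ compatible with restriction. Contexts denote products. Coercions denote the evident functorial actions and canonical morphisms; typing derivations denote morphisms $[\![\Gamma]\!]\to[\![\tau]\!]$ in the standard way, with $\mathsf{rec}$ the guarded fixpoint, $e\,\mathsf{by}\,p$ the functorial action of $\ast_p$, coercions composition and structure maps reindexing. Write $\Gamma\vdash e_1\cong e_2:\tau$ if $\Gamma\vdash e_i:\tau$ for $i=1,2$ and all typing derivations of $\Gamma\vdash e_1:\tau$ and of $\Gamma\vdash e_2:\tau$ denote the same morphism. **Theorem (completeness of algorithmic typing).** If $\Gamma\vdash e:\tau$, then there are $\tau^m,e^m,\alpha^m$ such that $\mathrm{Elab}(\Gamma,|e|)$ is defined and equal to $(\tau^m,e^m)$, $\Gamma\vdash e^m:\tau^m$, $\alpha^m:\tau^m<:\tau$, and $$\Gamma\vdash e\;\cong\;e^m;\alpha^m:\tau,\qquad\text{i.e.}\quad[\![\Gamma\vdash e:\tau]\!]=[\![\alpha^m:\tau^m<:\tau]\!]\circ[\![\Gamma\vdash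 e^m:\tau^m]\!].$$ -/

import Mathlib

universe u v

namespace WarpCalc

noncomputable section

/-! ### Time warps -/

/-- A time warp is a sup-preserving self-map of `ω + 1`; the order is pointwise. -/
abbrev TimeWarp : Type := sSupHom ℕ∞ ℕ∞

namespace TimeWarp

/-- The identity time warp. -/
def one : TimeWarp := sSupHom.id ℕ∞

/-- The time warp of the later modality, `n ↦ n - 1`. -/
def pred : TimeWarp where
  toFun n := n - 1
  map_sSup' A := by
    have gc : GaloisConnection (fun n : ℕ∞ => n - 1) (fun n : ℕ∞ => n + 1) :=
      fun _ _ => tsub_le_iff_right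
    rw [gc.l_sSup, sSup_image]

/-- The greatest time warp: `0 ↦ 0` and `n ↦ ω` for `0 < n`. -/
def omega : TimeWarp where
  toFun n := if n = 0 then 0 else ⊤
  map_sSup' A := by
    have gc : GaloisConnection (fun n : ℕ∞ => if n = 0 then (0 : ℕ∞) else ⊤)
        (fun n : ℕ∞ => if n = ⊤ then (⊤ : ℕ∞) else 0) := by
      intro a b
      by_cases ha : a = 0 <;> by_cases hb : b = ⊤ <;> simp [ha, hb]
    rw [gc.l_sSup, sSup_image]

/-- `p ∗ q` is `q ∘ p`. -/
def mul (p q : TimeWarp) : TimeWarp := q.comp p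

/-- Binary supremum of time warps. -/
def sup (p q : TimeWarp) : TimeWarp where
  toFun n := p n ⊔ q n
  map_sSup' A := by
    simp only [map_sSup, sSup_image]
    rw [← iSup_sup_eq]
    simp only [← iSup_sup_eq]

/-- Binary infimum of time warps. -/
def inf (p q : TimeWarp) : TimeWarp where
  toFun n := p n ⊓ q n
  map_sSup' A := by
    have hp : Monotone p := OrderHomClass.mono p
    have hq : Monotone q := OrderHomClass.mono q
    apply le_antisymm
    · rw [map_sSup, map_sSup, sSup_inf_sSup]
      refine iSup₂_le ?_
      rintro ⟨_, _⟩ ⟨⟨a, ha, rfl⟩, ⟨b, hb, rfl⟩⟩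
      rcases le_total a b with h | h
      · exact le_trans (inf_le_inf (hp h) le_rfl) (le_sSup ⟨b, hb, rfl⟩)
      · exact le_trans (inf_le_inf le_rfl (hq h)) (le_sSup ⟨a, ha, rfl⟩)
    · refine sSup_le ?_
      rintro _ ⟨a, ha, rfl⟩
      exact inf_le_inf (hp (le_sSup ha)) (hq (le_sSup ha))

/-- Division `q \ p`: the right adjoint of precomposition with `p`, that is, the greatest time
warp `r` such that `r ∘ p ≤ q`. -/
def div (q p : TimeWarp) : TimeWarp where
  toFun n := ⨆ r : {r : TimeWarp // mul p r ≤ q}, r.1 n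
  map_sSup' A := by
    simp only [map_sSup, sSup_image]
    rw [iSup_comm]
    exact iSup_congr fun a => iSup_comm

end TimeWarp

/-! ### Types, contexts, coercions -/

/-- Types over a set `G` of ground types. -/
inductive Ty (G : Type u) : Type u
  | ground (ν : G)
  | stream (τ : Ty G)
  | arrow (τ₁ τ₂ : Ty G)
  | prod (τ₁ τ₂ : Ty G)
  | sum (τ₁ τ₂ : Ty G)
  | warp (p : TimeWarp) (τ : Ty G)

/-- Contexts with `n` variables (de Bruijn indices, the most recent variable being `0`). -/
abbrev Ctx (G : Type u) (n : ℕ) : Type u := Fin n → Ty G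

/-- Context extension `Γ, x : τ`. -/
def Ctx.ext {G : Type u} {n : ℕ} (Γ : Ctx G n) (τ : Ty G) : Ctx G (n + 1) :=
  fun i => Fin.cases τ Γ i

/-- The context `∗_p Γ`. -/
def Ctx.warp {G : Type u} {n : ℕ} (p : TimeWarp) (Γ : Ctx G n) : Ctx G n :=
  fun i => Ty.warp p (Γ i)

/-- Raw coercions. -/
inductive Coercion : Type
  | id
  | comp (α₁ α₂ : Coercion)
  | stream (α : Coercion)
  | arrow (α₁ α₂ : Coercion)
  | prod (α₁ α₂ : Coercion)
  | sum (α₁ α₂ : Coercion)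
  | warp (p : TimeWarp) (α : Coercion)
  | wrap
  | unwrap
  | concat (p q : TimeWarp)
  | decat (p q : TimeWarp)
  | inflate
  | dist
  | fact
  | delay (p q : TimeWarp)

/-- Derivations of the subtyping judgment `α : τ <: τ'`. -/
inductive Sub {G : Type u} : Coercion → Ty G → Ty G → Type u
  | id (τ : Ty G) : Sub .id τ τ
  | comp {α₁ α₂ : Coercion} {τ₁ τ₂ τ₃ : Ty G} :
      Sub α₁ τ₁ τ₂ → Sub α₂ τ₂ τ₃ → Sub (.comp α₁ α₂) τ₁ τ₃
  | stream {α : Coercion} {τ τ' : Ty G} :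
      Sub α τ τ' → Sub (.stream α) (.stream τ) (.stream τ')
  | arrow {α₁ α₂ : Coercion} {τ₁ τ₁' τ₂ τ₂' : Ty G} :
      Sub α₁ τ₁' τ₁ → Sub α₂ τ₂ τ₂' → Sub (.arrow α₁ α₂) (.arrow τ₁ τ₂) (.arrow τ₁' τ₂')
  | prod {α₁ α₂ : Coercion} {τ₁ τ₁' τ₂ τ₂' : Ty G} :
      Sub α₁ τ₁ τ₁' → Sub α₂ τ₂ τ₂' → Sub (.prod α₁ α₂) (.prod τ₁ τ₂) (.prod τ₁' τ₂')
  | sum {α₁ α₂ : Coercion} {τ₁ τ₁' τ₂ τ₂' : Ty G} :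
      Sub α₁ τ₁ τ₁' → Sub α₂ τ₂ τ₂' → Sub (.sum α₁ α₂) (.sum τ₁ τ₂) (.sum τ₁' τ₂')
  | warp {α : Coercion} {τ τ' : Ty G} (p : TimeWarp) :
      Sub α τ τ' → Sub (.warp p α) (.warp p τ) (.warp p τ')
  | wrap (τ : Ty G) : Sub .wrap τ (.warp TimeWarp.one τ)
  | unwrap (τ : Ty G) : Sub .unwrap (.warp TimeWarp.one τ) τ
  | concat (p q : TimeWarp) (τ : Ty G) :
      Sub (.concat p q) (.warp p (.warp q τ)) (.warp (p.mul q) τ)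
  | decat (p q : TimeWarp) (τ : Ty G) :
      Sub (.decat p q) (.warp (p.mul q) τ) (.warp p (.warp q τ))
  | inflate (ν : G) : Sub .inflate (.ground ν) (.warp TimeWarp.omega (.ground ν))
  | dist (p : TimeWarp) (τ₁ τ₂ : Ty G) :
      Sub .dist (.warp p (.prod τ₁ τ₂)) (.prod (.warp p τ₁) (.warp p τ₂))
  | fact (p : TimeWarp) (τ₁ τ₂ : Ty G) :
      Sub .fact (.prod (.warp p τ₁) (.warp p τ₂)) (.warp p (.prod τ₁ τ₂))
  | delay {p q : TimeWarp} (h : q ≤ p) (τ : Ty G) :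
      Sub (.delay p q) (.warp p τ) (.warp q τ)

/-- The judgment `α : τ <: τ'`. -/
def HasSub {G : Type u} (α : Coercion) (τ τ' : Ty G) : Prop := Nonempty (Sub α τ τ')

/-! ### Explicit terms -/

/-- Explicit terms with free variables among `0, …, n - 1`. The scalars of ground type `ν` are
the elements of `S ν`.

`coeR e α` is the covariant coercion `e;α`. `coeL ρ β e` is the contravariant coercion `β;e`: the
variable `i` of `e` stands for the variable `ρ i` of the whole term, coerced along `β i`. The
typing rule for `β;e` uses `ρ = id` only; other `ρ` arise when a structure map, which
may identify variables coerced differently by `β`, is applied to such a term. -/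
inductive Tm (G : Type u) (S : G → Type v) : ℕ → Type (max u v)
  | var {n : ℕ} (i : Fin n) : Tm G S n
  | lam {n : ℕ} (τ : Ty G) (e : Tm G S (n + 1)) : Tm G S n
  | app {n : ℕ} (e₁ e₂ : Tm G S n) : Tm G S n
  | pair {n : ℕ} (e₁ e₂ : Tm G S n) : Tm G S n
  | proj₁ {n : ℕ} (e : Tm G S n) : Tm G S n
  | proj₂ {n : ℕ} (e : Tm G S n) : Tm G S n
  | inj₁ {n : ℕ} (τ₂ : Ty G) (e : Tm G S n) : Tm G S n
  | inj₂ {n : ℕ} (τ₁ : Ty G) (e : Tm G S n) : Tm G S n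
  | case {n : ℕ} (e : Tm G S n) (e₁ e₂ : Tm G S (n + 1)) : Tm G S n
  | head {n : ℕ} (e : Tm G S n) : Tm G S n
  | tail {n : ℕ} (e : Tm G S n) : Tm G S n
  | cons {n : ℕ} (e₁ e₂ : Tm G S n) : Tm G S n
  | const {n : ℕ} (ν : G) (s : S ν) : Tm G S n
  | fix {n : ℕ} (τ : Ty G) (e : Tm G S (n + 1)) : Tm G S n
  | by_ {n : ℕ} (e : Tm G S n) (p : TimeWarp) : Tm G S n
  | coeR {n : ℕ} (e : Tm G S n) (α : Coercion) : Tm G S n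
  | coeL {n m : ℕ} (ρ : Fin m → Fin n) (β : Fin m → Coercion) (e : Tm G S m) : Tm G S n

/-- A map of variables, extended under a binder. -/
def liftVar {n m : ℕ} (σ : Fin n → Fin m) : Fin (n + 1) → Fin (m + 1) :=
  fun i => Fin.cases 0 (fun j => (σ j).succ) i

/-- `σ[e]`: the application of a map of variables `σ` to a term. -/
def Tm.rename {G : Type u} {S : G → Type v} :
    {n m : ℕ} → (Fin n → Fin m) → Tm G S n → Tm G S m
  | _, _, σ, .var i => .var (σ i)
  | _, _, σ, .lam τ e => .lam τ (e.rename (liftVar σ))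
  | _, _, σ, .app e₁ e₂ => .app (e₁.rename σ) (e₂.rename σ)
  | _, _, σ, .pair e₁ e₂ => .pair (e₁.rename σ) (e₂.rename σ)
  | _, _, σ, .proj₁ e => .proj₁ (e.rename σ)
  | _, _, σ, .proj₂ e => .proj₂ (e.rename σ)
  | _, _, σ, .inj₁ τ₂ e => .inj₁ τ₂ (e.rename σ)
  | _, _, σ, .inj₂ τ₁ e => .inj₂ τ₁ (e.rename σ)
  | _, _, σ, .case e e₁ e₂ =>
      .case (e.rename σ) (e₁.rename (liftVar σ)) (e₂.rename (liftVar σ))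
  | _, _, σ, .head e => .head (e.rename σ)
  | _, _, σ, .tail e => .tail (e.rename σ)
  | _, _, σ, .cons e₁ e₂ => .cons (e₁.rename σ) (e₂.rename σ)
  | _, _, _, .const ν s => .const ν s
  | _, _, σ, .fix τ e => .fix τ (e.rename (liftVar σ))
  | _, _, σ, .by_ e p => .by_ (e.rename σ) p
  | _, _, σ, .coeR e α => .coeR (e.rename σ) α
  | _, _, σ, .coeL ρ β e => .coeL (fun i => σ (ρ i)) β e

/-- Erasure `|e|`: all coercions are removed. Implicit terms are the terms without
`coeR` and `coeL`. -/
def Tm.erase {G : Type u} {S : G → Type v} : {n : ℕ} → Tm G S n → Tm G S n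
  | _, .var i => .var i
  | _, .lam τ e => .lam τ e.erase
  | _, .app e₁ e₂ => .app e₁.erase e₂.erase
  | _, .pair e₁ e₂ => .pair e₁.erase e₂.erase
  | _, .proj₁ e => .proj₁ e.erase
  | _, .proj₂ e => .proj₂ e.erase
  | _, .inj₁ τ₂ e => .inj₁ τ₂ e.erase
  | _, .inj₂ τ₁ e => .inj₂ τ₁ e.erase
  | _, .case e e₁ e₂ => .case e.erase e₁.erase e₂.erase
  | _, .head e => .head e.erase
  | _, .tail e => .tail e.erase
  | _, .cons e₁ e₂ => .cons e₁.erase e₂.erase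
  | _, .const ν s => .const ν s
  | _, .fix τ e => .fix τ e.erase
  | _, .by_ e p => .by_ e.erase p
  | _, .coeR e _ => e.erase
  | _, .coeL ρ _ e => e.erase.rename ρ

/-- Derivations of the typing judgment `Γ ⊢ e : τ`. In `struct`, a structure map from `Γ` to `Γ'`
is a map `σ` of variables with `Γ = Γ' ∘ σ`. -/
inductive Typing {G : Type u} {S : G → Type v} :
    {n : ℕ} → Ctx G n → Tm G S n → Ty G → Type (max u v)
  | var {n : ℕ} {Γ : Ctx G n} (i : Fin n) : Typing Γ (.var i) (Γ i)
  | lam {n : ℕ} {Γ : Ctx G n} {e : Tm G S (n + 1)} {τ₁ τ₂ : Ty G} :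
      Typing (Γ.ext τ₁) e τ₂ → Typing Γ (.lam τ₁ e) (.arrow τ₁ τ₂)
  | app {n : ℕ} {Γ : Ctx G n} {e₁ e₂ : Tm G S n} {τ₁ τ₂ : Ty G} :
      Typing Γ e₁ (.arrow τ₁ τ₂) → Typing Γ e₂ τ₁ → Typing Γ (.app e₁ e₂) τ₂
  | pair {n : ℕ} {Γ : Ctx G n} {e₁ e₂ : Tm G S n} {τ₁ τ₂ : Ty G} :
      Typing Γ e₁ τ₁ → Typing Γ e₂ τ₂ → Typing Γ (.pair e₁ e₂) (.prod τ₁ τ₂)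
  | proj₁ {n : ℕ} {Γ : Ctx G n} {e : Tm G S n} {τ₁ τ₂ : Ty G} :
      Typing Γ e (.prod τ₁ τ₂) → Typing Γ (.proj₁ e) τ₁
  | proj₂ {n : ℕ} {Γ : Ctx G n} {e : Tm G S n} {τ₁ τ₂ : Ty G} :
      Typing Γ e (.prod τ₁ τ₂) → Typing Γ (.proj₂ e) τ₂
  | inj₁ {n : ℕ} {Γ : Ctx G n} {e : Tm G S n} {τ₁ τ₂ : Ty G} :
      Typing Γ e τ₁ → Typing Γ (.inj₁ τ₂ e) (.sum τ₁ τ₂)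
  | inj₂ {n : ℕ} {Γ : Ctx G n} {e : Tm G S n} {τ₁ τ₂ : Ty G} :
      Typing Γ e τ₂ → Typing Γ (.inj₂ τ₁ e) (.sum τ₁ τ₂)
  | case {n : ℕ} {Γ : Ctx G n} {e : Tm G S n} {e₁ e₂ : Tm G S (n + 1)} {τ₁ τ₂ τ : Ty G} :
      Typing Γ e (.sum τ₁ τ₂) → Typing (Γ.ext τ₁) e₁ τ → Typing (Γ.ext τ₂) e₂ τ →
        Typing Γ (.case e e₁ e₂) τ
  | head {n : ℕ} {Γ : Ctx G n} {e : Tm G S n} {τ : Ty G} :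
      Typing Γ e (.stream τ) → Typing Γ (.head e) τ
  | tail {n : ℕ} {Γ : Ctx G n} {e : Tm G S n} {τ : Ty G} :
      Typing Γ e (.stream τ) → Typing Γ (.tail e) (.warp TimeWarp.pred (.stream τ))
  | cons {n : ℕ} {Γ : Ctx G n} {e₁ e₂ : Tm G S n} {τ : Ty G} :
      Typing Γ e₁ τ → Typing Γ e₂ (.warp TimeWarp.pred (.stream τ)) →
        Typing Γ (.cons e₁ e₂) (.stream τ)
  | const {n : ℕ} {Γ : Ctx G n} (ν : G) (s : S ν) : Typing Γ (.const ν s) (.ground ν)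
  | fix {n : ℕ} {Γ : Ctx G n} {e : Tm G S (n + 1)} {τ : Ty G} :
      Typing (Γ.ext (.warp TimeWarp.pred τ)) e τ → Typing Γ (.fix τ e) τ
  | by_ {n : ℕ} {Γ : Ctx G n} {e : Tm G S n} {τ : Ty G} (p : TimeWarp) :
      Typing Γ e τ → Typing (Γ.warp p) (.by_ e p) (.warp p τ)
  | subR {n : ℕ} {Γ : Ctx G n} {e : Tm G S n} {α : Coercion} {τ τ' : Ty G} :
      Typing Γ e τ → Sub α τ τ' → Typing Γ (.coeR e α) τ'
  | subL {n : ℕ} {Γ Γ' : Ctx G n} {e : Tm G S n} {β : Fin n → Coercion} {τ : Ty G} :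
      (∀ i, Sub (β i) (Γ i) (Γ' i)) → Typing Γ' e τ → Typing Γ (.coeL (fun i => i) β e) τ
  | struct {n m : ℕ} {Γ' : Ctx G m} {e : Tm G S n} {τ : Ty G} (σ : Fin n → Fin m) :
      Typing (fun i => Γ' (σ i)) e τ → Typing Γ' (e.rename σ) τ

/-- The judgment `Γ ⊢ e : τ`. -/
def HasType {G : Type u} {S : G → Type v} {n : ℕ} (Γ : Ctx G n) (e : Tm G S n) (τ : Ty G) :
    Prop := Nonempty (Typing Γ e τ)

/-! ### Algorithmic subtyping -/

/-- Normalization of `∗_p τ` for a normal type `τ`; normal types are products and warped types,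
so the last clause is never used. -/
def Ty.push {G : Type u} (p : TimeWarp) : Ty G → Ty G
  | .prod τ₁ τ₂ => .prod (τ₁.push p) (τ₂.push p)
  | .warp q τ => .warp (p.mul q) τ
  | τ => .warp p τ

/-- Type normalization. -/
def Ty.normal {G : Type u} : Ty G → Ty G
  | .ground ν => .warp TimeWarp.omega (.ground ν)
  | .stream τ => .warp TimeWarp.one (.stream τ.normal)
  | .arrow τ₁ τ₂ => .warp TimeWarp.one (.arrow τ₁.normal τ₂.normal)
  | .prod τ₁ τ₂ => .prod τ₁.normal τ₂.normal
  | .sum τ₁ τ₂ => .warp TimeWarp.one (.sum τ₁.normal τ₂.normal)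
  | .warp p τ => τ.normal.push p

/-- For a normal type `τ`, a coercion from `∗_p τ` to `τ.push p`. -/
def pushIn {G : Type u} (p : TimeWarp) : Ty G → Coercion
  | .prod τ₁ τ₂ => .comp .dist (.prod (pushIn p τ₁) (pushIn p τ₂))
  | .warp q _ => .concat p q
  | _ => .id

/-- For a normal type `τ`, a coercion from `τ.push p` to `∗_p τ`. -/
def pushOut {G : Type u} (p : TimeWarp) : Ty G → Coercion
  | .prod τ₁ τ₂ => .comp (.prod (pushOut p τ₁) (pushOut p τ₂)) .fact
  | .warp q _ => .decat p q
  | _ => .id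

mutual

/-- The coercion from `τ` to its normal form. -/
def normIn {G : Type u} : Ty G → Coercion
  | .ground _ => .inflate
  | .stream τ => .comp (.stream (normIn τ)) .wrap
  | .arrow τ₁ τ₂ => .comp (.arrow (normOut τ₁) (normIn τ₂)) .wrap
  | .prod τ₁ τ₂ => .prod (normIn τ₁) (normIn τ₂)
  | .sum τ₁ τ₂ => .comp (.sum (normIn τ₁) (normIn τ₂)) .wrap
  | .warp p (.prod τ₁ τ₂) => .comp .dist (.prod (normIn (.warp p τ₁)) (normIn (.warp p τ₂)))
  | .warp p τ => .comp (.warp p (normIn τ)) (pushIn p τ.normal)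
termination_by τ => sizeOf τ

/-- The coercion from the normal form of `τ` to `τ`. -/
def normOut {G : Type u} : Ty G → Coercion
  | .ground _ => .comp (.delay TimeWarp.omega TimeWarp.one) .unwrap
  | .stream τ => .comp .unwrap (.stream (normOut τ))
  | .arrow τ₁ τ₂ => .comp .unwrap (.arrow (normIn τ₁) (normOut τ₂))
  | .prod τ₁ τ₂ => .prod (normOut τ₁) (normOut τ₂)
  | .sum τ₁ τ₂ => .comp .unwrap (.sum (normOut τ₁) (normOut τ₂))
  | .warp p (.prod τ₁ τ₂) => .comp (.prod (normOut (.warp p τ₁)) (normOut (.warp p τ₂))) .fact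
  | .warp p τ => .comp (pushOut p τ.normal) (.warp p (normOut τ))
termination_by τ => sizeOf τ

end

open Classical in
/-- Type precedence: the partial function building a coercion out of delays only. -/
def prec {G : Type u} : Ty G → Ty G → Option Coercion
  | .ground ν, .ground ν' => if ν = ν' then some .id else none
  | .stream τ₁, .stream τ₂ => do
      let α ← prec τ₁ τ₂
      return .stream α
  | .arrow τ₁ τ₁', .arrow τ₂ τ₂' => do
      let α ← prec τ₂ τ₁
      let α' ← prec τ₁' τ₂'
      return .arrow α α'
  | .prod τ₁ τ₁', .prod τ₂ τ₂' => do
      let α ← prec τ₁ τ₂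
      let α' ← prec τ₁' τ₂'
      return .prod α α'
  | .sum τ₁ τ₁', .sum τ₂ τ₂' => do
      let α ← prec τ₁ τ₂
      let α' ← prec τ₁' τ₂'
      return .sum α α'
  | .warp p τ₁, .warp q τ₂ =>
      if q ≤ p then do
        let α ← prec τ₁ τ₂
        return .comp (.delay p q) (.warp q α)
      else none
  | _, _ => none
termination_by τ τ' => sizeOf τ + sizeOf τ'

/-- Algorithmic subtyping: the partial function building a coercion from `τ` to `τ'`. -/
def coerce {G : Type u} (τ τ' : Ty G) : Option Coercion := do
  let α ← prec τ.normal τ'.normal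
  return .comp (.comp (normIn τ) α) (normOut τ')

/-- Pointwise extension of `coerce` to contexts. -/
def coerceCtx {G : Type u} {n : ℕ} (Γ Γ' : Ctx G n) :
    Option (Fin n → Coercion) :=
  if h : ∀ i, (coerce (Γ i) (Γ' i)).isSome then
    some fun i => (coerce (Γ i) (Γ' i)).get (h i)
  else none

/-- Division of a normal type by a time warp; the last clause is never used on normal types. -/
def Ty.divNormal {G : Type u} : Ty G → TimeWarp → Ty G
  | .prod τ₁ τ₂, p => .prod (τ₁.divNormal p) (τ₂.divNormal p)
  | .warp q τ, p => .warp (q.div p) τ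
  | τ, _ => τ

/-- Division of a context by a time warp. -/
def Ctx.div {G : Type u} {n : ℕ} (Γ : Ctx G n) (p : TimeWarp) : Ctx G n :=
  fun i => (Γ i).normal.divNormal p

open Classical in
mutual

/-- Partial suprema of normal types. -/
def supNormal {G : Type u} : Ty G → Ty G → Option (Ty G)
  | .ground ν, .ground ν' => if ν = ν' then some (.ground ν) else none
  | .stream τ, .stream τ' => do
      let σ ← supNormal τ τ'
      return .stream σ
  | .arrow τ₁ τ₂, .arrow τ₁' τ₂' => do
      let σ₁ ← infNormal τ₁ τ₁'
      let σ₂ ← supNormal τ₂ τ₂'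
      return .arrow σ₁ σ₂
  | .prod τ₁ τ₂, .prod τ₁' τ₂' => do
      let σ₁ ← supNormal τ₁ τ₁'
      let σ₂ ← supNormal τ₂ τ₂'
      return .prod σ₁ σ₂
  | .sum τ₁ τ₂, .sum τ₁' τ₂' => do
      let σ₁ ← supNormal τ₁ τ₁'
      let σ₂ ← supNormal τ₂ τ₂'
      return .sum σ₁ σ₂
  | .warp p τ, .warp q τ' => do
      let σ ← supNormal τ τ'
      return .warp (p.inf q) σ
  | _, _ => none

/-- Partial infima of normal types. -/
def infNormal {G : Type u} : Ty G → Ty G → Option (Ty G)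
  | .ground ν, .ground ν' => if ν = ν' then some (.ground ν) else none
  | .stream τ, .stream τ' => do
      let σ ← infNormal τ τ'
      return .stream σ
  | .arrow τ₁ τ₂, .arrow τ₁' τ₂' => do
      let σ₁ ← supNormal τ₁ τ₁'
      let σ₂ ← infNormal τ₂ τ₂'
      return .arrow σ₁ σ₂
  | .prod τ₁ τ₂, .prod τ₁' τ₂' => do
      let σ₁ ← infNormal τ₁ τ₁'
      let σ₂ ← infNormal τ₂ τ₂'
      return .prod σ₁ σ₂
  | .sum τ₁ τ₂, .sum τ₁' τ₂' => do
      let σ₁ ← infNormal τ₁ τ₁'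
      let σ₂ ← infNormal τ₂ τ₂'
      return .sum σ₁ σ₂
  | .warp p τ, .warp q τ' => do
      let σ ← infNormal τ τ'
      return .warp (p.sup q) σ
  | _, _ => none

end

/-- Partial suprema of types. -/
def Ty.sup? {G : Type u} (τ₁ τ₂ : Ty G) : Option (Ty G) :=
  supNormal τ₁.normal τ₂.normal

/-! ### Elaboration -/

/-- The elaboration function, a partial function of a context and an implicit term. -/
def elaborate {G : Type u} {S : G → Type v} :
    {n : ℕ} → Ctx G n → Tm G S n → Option (Ty G × Tm G S n)
  | _, Γ, .var i => some (Γ i, .var i)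
  | _, Γ, .lam τ t =>
      (elaborate (Γ.ext τ) t).bind fun (τ', e) =>
      some (.arrow τ τ', .lam τ e)
  | _, Γ, .app t₁ t₂ =>
      (elaborate Γ t₁).bind fun (τ₁, e₁) =>
      (elaborate Γ t₂).bind fun (τ₂, e₂) =>
      match τ₁.normal with
      | .warp _ (.arrow τ₁' τ₁'') =>
          (coerce τ₁ (.arrow τ₁' τ₁'')).bind fun α₁ =>
          (coerce τ₂ τ₁').bind fun α₂ =>
          some (τ₁'', .app (.coeR e₁ α₁) (.coeR e₂ α₂))
      | _ => none
  | _, Γ, .pair t₁ t₂ =>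
      (elaborate Γ t₁).bind fun (τ₁, e₁) =>
      (elaborate Γ t₂).bind fun (τ₂, e₂) =>
      some (.prod τ₁ τ₂, .pair e₁ e₂)
  | _, Γ, .proj₁ t =>
      (elaborate Γ t).bind fun (τ, e) =>
      match τ.normal with
      | .prod τ₁ τ₂ =>
          (coerce τ (.prod τ₁ τ₂)).bind fun α =>
          some (τ₁, .proj₁ (.coeR e α))
      | _ => none
  | _, Γ, .proj₂ t =>
      (elaborate Γ t).bind fun (τ, e) =>
      match τ.normal with
      | .prod τ₁ τ₂ =>
          (coerce τ (.prod τ₁ τ₂)).bind fun α =>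
          some (τ₂, .proj₂ (.coeR e α))
      | _ => none
  | _, Γ, .inj₁ τ₂ t =>
      (elaborate Γ t).bind fun (τ₁, e) =>
      some (.sum τ₁ τ₂, .inj₁ τ₂ e)
  | _, Γ, .inj₂ τ₁ t =>
      (elaborate Γ t).bind fun (τ₂, e) =>
      some (.sum τ₁ τ₂, .inj₂ τ₁ e)
  | _, Γ, .case t t₁ t₂ =>
      (elaborate Γ t).bind fun (τ, e) =>
      match τ.normal with
      | .warp _ (.sum τ₁ τ₂) =>
          (coerce τ (.sum τ₁ τ₂)).bind fun α =>
          (elaborate (Γ.ext τ₁) t₁).bind fun (τ₁', e₁) =>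
          (elaborate (Γ.ext τ₂) t₂).bind fun (τ₂', e₂) =>
          (τ₁'.sup? τ₂').bind fun τ' =>
          (coerce τ₁' τ').bind fun α₁ =>
          (coerce τ₂' τ').bind fun α₂ =>
          some (τ', .case (.coeR e α) (.coeR e₁ α₁) (.coeR e₂ α₂))
      | _ => none
  | _, _, .const ν s => some (.ground ν, .const ν s)
  | _, Γ, .fix τ t =>
      (elaborate (Γ.ext (.warp TimeWarp.pred τ)) t).bind fun (τ', e) =>
      (coerce τ' τ).bind fun α =>
      some (τ, .fix τ (.coeR e α))
  | _, Γ, .by_ t p =>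
      (elaborate (Γ.div p) t).bind fun (τ, e) =>
      (coerceCtx Γ ((Γ.div p).warp p)).bind fun β =>
      some (.warp p τ, .coeL (fun i => i) β (.by_ e p))
  | _, Γ, .head t =>
      (elaborate Γ t).bind fun (τ, e) =>
      match τ.normal with
      | .warp _ (.stream τ') =>
          (coerce τ (.stream τ')).bind fun α =>
          some (τ', .head (.coeR e α))
      | _ => none
  | _, Γ, .tail t =>
      (elaborate Γ t).bind fun (τ, e) =>
      match τ.normal with
      | .warp _ (.stream τ') =>
          (coerce τ (.stream τ')).bind fun α =>
          some (.warp TimeWarp.pred (.stream τ'), .tail (.coeR e α))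
      | _ => none
  | _, Γ, .cons t₁ t₂ =>
      (elaborate Γ t₁).bind fun (τ₁, e₁) =>
      (elaborate Γ t₂).bind fun (τ₂, e₂) =>
      match τ₂.normal with
      | .warp _ (.stream τ₂') =>
          (τ₁.sup? τ₂').bind fun τ =>
          (coerce τ₁ τ).bind fun α₁ =>
          (coerce τ₂ (.warp TimeWarp.pred (.stream τ))).bind fun α₂ =>
          some (.stream τ, .cons (.coeR e₁ α₁) (.coeR e₂ α₂))
      | _ => none
  | _, _, .coeR _ _ => none
  | _, _, .coeL _ _ _ => none

/-! ### The topos of trees -/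

/-- Objects of the topos of trees, i.e. presheaves on `ω`. The index `n : ℕ` stands for the time
step `n + 1`, as `ω` begins at `1`. -/
structure TreeObj : Type (v + 1) where
  obj : ℕ → Type v
  res : ∀ {m n : ℕ}, m ≤ n → obj n → obj m
  res_self : ∀ {n : ℕ} (h : n ≤ n) (x : obj n), res h x = x
  res_res : ∀ {k m n : ℕ} (h : k ≤ m) (h' : m ≤ n) (x : obj n),
    res h (res h' x) = res (h.trans h') x

/-- Morphisms of the topos of trees. -/
@[ext]
structure TreeHom (X Y : TreeObj.{v}) : Type v where
  app : ∀ n, X.obj n → Y.obj n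
  nat : ∀ {m n : ℕ} (h : m ≤ n) (x : X.obj n), app m (X.res h x) = Y.res h (app n x)

/-- The identity morphism. -/
def TreeHom.id (X : TreeObj.{v}) : TreeHom X X := ⟨fun _ x => x, fun _ _ => rfl⟩

/-- Composition, in diagrammatic order. -/
def TreeHom.comp {X Y Z : TreeObj.{v}} (f : TreeHom X Y) (g : TreeHom Y Z) : TreeHom X Z :=
  ⟨fun n x => g.app n (f.app n x), fun h x => by rw [f.nat, g.nat]⟩

namespace TreeObj

/-- The constant presheaf. -/
abbrev const (A : Type v) : TreeObj.{v} := ⟨fun _ => A, fun _ x => x, fun _ _ => rfl, fun _ _ _ => rfl⟩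

/-- Binary products, pointwise. -/
abbrev prod (X Y : TreeObj.{v}) : TreeObj.{v} where
  obj n := X.obj n × Y.obj n
  res h x := (X.res h x.1, Y.res h x.2)
  res_self h x := by simp [X.res_self, Y.res_self]
  res_res h h' x := by simp [X.res_res, Y.res_res]

/-- Binary coproducts, pointwise. -/
abbrev sum (X Y : TreeObj.{v}) : TreeObj.{v} where
  obj n := X.obj n ⊕ Y.obj n
  res h := Sum.map (X.res h) (Y.res h)
  res_self h x := by cases x <;> simp [X.res_self, Y.res_self]
  res_res h h' x := by cases x <;> simp [X.res_res, Y.res_res]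

/-- Finite products, pointwise. -/
abbrev pi {n : ℕ} (X : Fin n → TreeObj.{v}) : TreeObj.{v} where
  obj k := ∀ i, (X i).obj k
  res h x := fun i => (X i).res h (x i)
  res_self h x := by funext i; exact (X i).res_self h (x i)
  res_res h h' x := by funext i; exact (X i).res_res h h' (x i)

/-- Exponentials `Y ^ X`: at `n`, natural families of maps `X m → Y m` for `m ≤ n`. -/
abbrev exp (X Y : TreeObj.{v}) : TreeObj.{v} where
  obj n := {f : ∀ m, m ≤ n → X.obj m → Y.obj m //
    ∀ (k m : ℕ) (h : k ≤ m) (hm : m ≤ n) (x : X.obj m),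
      f k (h.trans hm) (X.res h x) = Y.res h (f m hm x)}
  res h f := ⟨fun m hm => f.1 m (hm.trans h), fun k m hk hm x => f.2 k m hk (hm.trans h) x⟩
  res_self _ _ := rfl
  res_res _ _ _ := rfl

/-- Streams: `∏ τ(m)` for `m` up to the current step `n`, listed downwards from `n`, so that the
component `k`, which lies at step `n - k`, is the `k`-th element of the stream. -/
abbrev stream (X : TreeObj.{v}) : TreeObj.{v} where
  obj n := ∀ k, k ≤ n → X.obj (n - k)
  res h s := fun k hk => X.res (Nat.sub_le_sub_right h k) (s k (hk.trans h))
  res_self h s := by funext k hk; exact X.res_self _ _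
  res_res h h' s := by funext k hk; exact X.res_res _ _ _

/-- The time step, in `ω + 1`, that the index `n` stands for. -/
def step (n : ℕ) : ℕ∞ := ((n + 1 : ℕ) : ℕ∞)

theorem step_mono {m n : ℕ} (h : m ≤ n) : step m ≤ step n := by
  unfold step; exact_mod_cast Nat.succ_le_succ h

/-- The warping functor on objects: at a step `n`, compatible families indexed by the steps
`m ≤ p n`. -/
abbrev warp (p : TimeWarp) (X : TreeObj.{v}) : TreeObj.{v} where
  obj n := {x : ∀ m, step m ≤ p (step n) → X.obj m //
    ∀ (k m : ℕ) (h : k ≤ m) (hm : step m ≤ p (step n)),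
      x k ((step_mono h).trans hm) = X.res h (x m hm)}
  res h x := ⟨fun m hm => x.1 m (hm.trans (OrderHomClass.mono p (step_mono h))),
    fun k m hk hm => x.2 k m hk (hm.trans (OrderHomClass.mono p (step_mono h)))⟩
  res_self _ _ := rfl
  res_res _ _ _ := rfl

end TreeObj

open TreeObj

namespace TreeHom

/-- Functorial action of streams. -/
def streamMap {X Y : TreeObj.{v}} (f : TreeHom X Y) : TreeHom (stream X) (stream Y) where
  app _ s := fun k hk => f.app _ (s k hk)
  nat _ _ := by funext k hk; exact f.nat _ _

/-- Functorial action of exponentials. -/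
def expMap {X X' Y Y' : TreeObj.{v}} (f : TreeHom X' X) (g : TreeHom Y Y') :
    TreeHom (exp X Y) (exp X' Y') where
  app _ φ := ⟨fun m hm x => g.app m (φ.1 m hm (f.app m x)),
    fun k m h hm x => (congrArg (g.app k) ((congrArg (φ.1 k _) (f.nat h x)).trans
      (φ.2 k m h hm _))).trans (g.nat h _)⟩
  nat _ _ := rfl

/-- Functorial action of products. -/
def prodMap {X X' Y Y' : TreeObj.{v}} (f : TreeHom X X') (g : TreeHom Y Y') :
    TreeHom (prod X Y) (prod X' Y') where
  app n x := (f.app n x.1, g.app n x.2)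
  nat h x := Prod.ext (f.nat h x.1) (g.nat h x.2)

/-- Functorial action of coproducts. -/
def sumMap {X X' Y Y' : TreeObj.{v}} (f : TreeHom X X') (g : TreeHom Y Y') :
    TreeHom (sum X Y) (sum X' Y') where
  app n := Sum.map (f.app n) (g.app n)
  nat h x := by
    cases x with
    | inl x => exact congrArg Sum.inl (f.nat h x)
    | inr x => exact congrArg Sum.inr (g.nat h x)

/-- Functorial action of warping. -/
def warpMap (p : TimeWarp) {X Y : TreeObj.{v}} (f : TreeHom X Y) :
    TreeHom (warp p X) (warp p Y) where
  app _ x := ⟨fun m hm => f.app m (x.1 m hm), fun k m h hm =>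
    (congrArg (f.app k) (x.2 k m h hm)).trans (f.nat h _)⟩
  nat _ _ := rfl

/-- The isomorphism from `X` to `∗_id X`. -/
def wrap (X : TreeObj.{v}) : TreeHom X (warp TimeWarp.one X) where
  app n x := ⟨fun m hm => X.res (by
      have h : step m ≤ step n := hm
      unfold step at h
      exact Nat.le_of_succ_le_succ (by exact_mod_cast h)) x,
    fun k m h hm => by rw [X.res_res]⟩
  nat h x := by
    apply Subtype.ext
    funext m hm
    exact X.res_res _ _ _

/-- The isomorphism from `∗_id X` to `X`. -/
def unwrap (X : TreeObj.{v}) : TreeHom (warp TimeWarp.one X) X where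
  app n x := x.1 n le_rfl
  nat {m n} h x := x.2 m n h le_rfl

theorem exists_step {p q : TimeWarp} {n k : ℕ} (hk : step k ≤ p.mul q (step n)) :
    ∃ m, step m ≤ p (step n) ∧ step k ≤ q (step m) := by
  have hk' : step k ≤ q (p (step n)) := hk
  by_contra hcon
  push Not at hcon
  have hlt : ∀ a : ℕ, (a : ℕ∞) ≤ p (step n) → q (a : ℕ∞) ≤ k := by
    intro a ha
    cases a with
    | zero =>
      have : q (⊥ : ℕ∞) = ⊥ := map_bot q
      have h0 : q ((0 : ℕ) : ℕ∞) = 0 := this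
      rw [h0]; exact zero_le
    | succ a =>
      have h := hcon a ha
      unfold step at h
      have h' : q ((a + 1 : ℕ) : ℕ∞) < (k : ℕ∞) + 1 := by exact_mod_cast h
      exact Order.le_of_lt_add_one h'
  have hsup : p (step n) = sSup ((fun a : ℕ => (a : ℕ∞)) '' {a : ℕ | (a : ℕ∞) ≤ p (step n)}) := by
    apply le_antisymm
    · refine ENat.forall_natCast_le_iff_le.mp fun a ha => ?_
      exact le_sSup ⟨a, ha, rfl⟩
    · refine sSup_le ?_
      rintro _ ⟨a, ha, rfl⟩
      exact ha
  have hle : q (p (step n)) ≤ (k : ℕ∞) := by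
    rw [hsup, map_sSup]
    refine sSup_le ?_
    rintro _ ⟨_, ⟨a, ha, rfl⟩, rfl⟩
    exact hlt a ha
  have h2 : step k ≤ (k : ℕ∞) := hk'.trans hle
  unfold step at h2
  have h3 : k + 1 ≤ k := by exact_mod_cast h2
  omega

theorem warp_warp_indep {p q : TimeWarp} {X : TreeObj.{v}} {n : ℕ}
    (x : (warp p (warp q X)).obj n) {k m m' : ℕ} (hm : step m ≤ p (step n))
    (hm' : step m' ≤ p (step n)) (hk : step k ≤ q (step m)) (hk' : step k ≤ q (step m')) :
    (x.1 m hm).1 k hk = (x.1 m' hm').1 k hk' := by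
  rcases le_total m m' with h | h
  · have e := x.2 m m' h hm'
    rw [e]
  · have e := x.2 m' m h hm
    rw [e]

/-- The isomorphism from `∗_p ∗_q X` to `∗_(p ∗ q) X`: the component at `k` is read at any step `m`
with `m ≤ p n` and `k ≤ q m`. -/
def concat (p q : TimeWarp) (X : TreeObj.{v}) :
    TreeHom (warp p (warp q X)) (warp (p.mul q) X) where
  app _ x := ⟨fun k hk => (x.1 (exists_step hk).choose (exists_step hk).choose_spec.1).1 k
      (exists_step hk).choose_spec.2, fun k m h hm => by
    rw [← (x.1 (exists_step hm).choose (exists_step hm).choose_spec.1).2 k m h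
      (exists_step hm).choose_spec.2]
    exact warp_warp_indep x _ _ _ _⟩
  nat h x := by
    apply Subtype.ext
    funext k hk
    exact warp_warp_indep x _ _ _ _

/-- The isomorphism from `∗_(p ∗ q) X` to `∗_p ∗_q X`. -/
def decat (p q : TimeWarp) (X : TreeObj.{v}) :
    TreeHom (warp (p.mul q) X) (warp p (warp q X)) where
  app _ x := ⟨fun _ hm => ⟨fun k hk => x.1 k (hk.trans (OrderHomClass.mono q hm)),
      fun k l h hl => x.2 k l h (hl.trans (OrderHomClass.mono q hm))⟩, fun _ _ _ _ => rfl⟩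
  nat _ _ := rfl

/-- The isomorphism from a constant presheaf `X` to `∗_ω X`. -/
def inflate (A : Type v) :
    TreeHom (TreeObj.const A) (warp TimeWarp.omega (TreeObj.const A)) where
  app _ x := ⟨fun _ _ => x, fun _ _ _ _ => rfl⟩
  nat _ _ := rfl

/-- Warping distributes over products. -/
def dist (p : TimeWarp) (X Y : TreeObj.{v}) :
    TreeHom (warp p (prod X Y)) (prod (warp p X) (warp p Y)) where
  app _ x := (⟨fun m hm => (x.1 m hm).1, fun k m h hm => congrArg Prod.fst (x.2 k m h hm)⟩,
    ⟨fun m hm => (x.1 m hm).2, fun k m h hm => congrArg Prod.snd (x.2 k m h hm)⟩)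
  nat _ _ := rfl

/-- Warping factors out of products. -/
def fact (p : TimeWarp) (X Y : TreeObj.{v}) :
    TreeHom (prod (warp p X) (warp p Y)) (warp p (prod X Y)) where
  app _ x := ⟨fun m hm => (x.1.1 m hm, x.2.1 m hm),
    fun k m h hm => Prod.ext (x.1.2 k m h hm) (x.2.2 k m h hm)⟩
  nat _ _ := rfl

/-- The natural transformation from `∗_p` to `∗_q` for `q ≤ p`. -/
def delay {p q : TimeWarp} (hqp : q ≤ p) (X : TreeObj.{v}) : TreeHom (warp p X) (warp q X) where
  app n x := ⟨fun m hm => x.1 m (hm.trans (hqp (step n))),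
    fun k m h hm => x.2 k m h (hm.trans (hqp (step n)))⟩
  nat _ _ := rfl

end TreeHom

/-! ### The interpretation -/

/-- The interpretation of types. -/
def Ty.sem {G : Type u} (S : G → Type v) : Ty G → TreeObj.{v}
  | .ground ν => TreeObj.const (S ν)
  | .stream τ => TreeObj.stream (τ.sem S)
  | .arrow τ₁ τ₂ => TreeObj.exp (τ₁.sem S) (τ₂.sem S)
  | .prod τ₁ τ₂ => TreeObj.prod (τ₁.sem S) (τ₂.sem S)
  | .sum τ₁ τ₂ => TreeObj.sum (τ₁.sem S) (τ₂.sem S)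
  | .warp p τ => TreeObj.warp p (τ.sem S)

/-- The interpretation of contexts. -/
def Ctx.sem {G : Type u} (S : G → Type v) {n : ℕ} (Γ : Ctx G n) : TreeObj.{v} :=
  pi fun i => (Γ i).sem S

/-- The interpretation of coercions. -/
def Sub.sem {G : Type u} (S : G → Type v) {α : Coercion} {τ τ' : Ty G} :
    Sub α τ τ' → TreeHom (τ.sem S) (τ'.sem S)
  | .id τ => TreeHom.id (τ.sem S)
  | .comp a b => (a.sem S).comp (b.sem S)
  | .stream a => (a.sem S).streamMap
  | .arrow a b => TreeHom.expMap (a.sem S) (b.sem S)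
  | .prod a b => TreeHom.prodMap (a.sem S) (b.sem S)
  | .sum a b => TreeHom.sumMap (a.sem S) (b.sem S)
  | .warp p a => TreeHom.warpMap p (a.sem S)
  | .wrap τ => TreeHom.wrap (τ.sem S)
  | .unwrap τ => TreeHom.unwrap (τ.sem S)
  | .concat p q τ => TreeHom.concat p q (τ.sem S)
  | .decat p q τ => TreeHom.decat p q (τ.sem S)
  | .inflate ν => TreeHom.inflate (S ν)
  | .dist p τ₁ τ₂ => TreeHom.dist p (τ₁.sem S) (τ₂.sem S)
  | .fact p τ₁ τ₂ => TreeHom.fact p (τ₁.sem S) (τ₂.sem S)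
  | .delay h τ => TreeHom.delay h (τ.sem S)

section Terms

/-- Extension of an environment. -/
def extEnv {G : Type u} {S : G → Type v} {n k : ℕ} {Γ : Ctx G n} {τ : Ty G}
    (γ : (Γ.sem S).obj k) (x : (τ.sem S).obj k) : ((Γ.ext τ).sem S).obj k :=
  fun i => Fin.cases (motive := fun i => ((Γ.ext τ i).sem S).obj k) x γ i

theorem res_extEnv {G : Type u} {S : G → Type v} {n k l : ℕ} {Γ : Ctx G n} {τ : Ty G}
    (h : k ≤ l) (γ : (Γ.sem S).obj l) (x : (τ.sem S).obj l) :
    ((Γ.ext τ).sem S).res h (extEnv γ x) = extEnv ((Γ.sem S).res h γ) ((τ.sem S).res h x) := by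
  funext i
  refine Fin.cases ?_ (fun j => ?_) i <;> rfl

namespace TreeHom

variable {G : Type u} {S : G → Type v} {n : ℕ} {Γ : Ctx G n} {τ : Ty G}

/-- Projection to a variable. -/
def lookup (S : G → Type v) (Γ : Ctx G n) (i : Fin n) : TreeHom (Γ.sem S) ((Γ i).sem S) :=
  ⟨fun _ γ => γ i, fun _ _ => rfl⟩

/-- Currying. -/
def curry {Y : TreeObj.{v}} (f : TreeHom ((Γ.ext τ).sem S) Y) :
    TreeHom (Γ.sem S) (exp (τ.sem S) Y) where
  app _ γ := ⟨fun m hm x => f.app m (extEnv ((Γ.sem S).res hm γ) x), fun k m h hm x => by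
    rw [← f.nat, res_extEnv, (Γ.sem S).res_res]⟩
  nat h γ := by
    apply Subtype.ext
    funext m hm x
    show f.app m (extEnv ((Γ.sem S).res hm ((Γ.sem S).res h γ)) x) = _
    rw [(Γ.sem S).res_res]

/-- Application. -/
def apply {Z X Y : TreeObj.{v}} (f : TreeHom Z (exp X Y)) (g : TreeHom Z X) : TreeHom Z Y where
  app n z := (f.app n z).1 n le_rfl (g.app n z)
  nat {m n} h z := by
    rw [f.nat, g.nat]
    exact (f.app n z).2 m n h le_rfl (g.app n z)

/-- Pairing. -/
def pair {Z X Y : TreeObj.{v}} (f : TreeHom Z X) (g : TreeHom Z Y) : TreeHom Z (prod X Y) where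
  app n z := (f.app n z, g.app n z)
  nat h z := Prod.ext (f.nat h z) (g.nat h z)

/-- First projection. -/
def fst (X Y : TreeObj.{v}) : TreeHom (prod X Y) X := ⟨fun _ x => x.1, fun _ _ => rfl⟩

/-- Second projection. -/
def snd (X Y : TreeObj.{v}) : TreeHom (prod X Y) Y := ⟨fun _ x => x.2, fun _ _ => rfl⟩

/-- First injection. -/
def inl (X Y : TreeObj.{v}) : TreeHom X (sum X Y) := ⟨fun _ x => Sum.inl x, fun _ _ => rfl⟩

/-- Second injection. -/
def inr (X Y : TreeObj.{v}) : TreeHom Y (sum X Y) := ⟨fun _ x => Sum.inr x, fun _ _ => rfl⟩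

/-- Case analysis. -/
def cases {τ₁ τ₂ : Ty G} {Y : TreeObj.{v}}
    (f : TreeHom (Γ.sem S) (sum (τ₁.sem S) (τ₂.sem S)))
    (f₁ : TreeHom ((Γ.ext τ₁).sem S) Y) (f₂ : TreeHom ((Γ.ext τ₂).sem S) Y) :
    TreeHom (Γ.sem S) Y where
  app n γ := Sum.elim (fun x => f₁.app n (extEnv γ x)) (fun x => f₂.app n (extEnv γ x)) (f.app n γ)
  nat {m n} h γ := by
    rw [f.nat]
    rcases f.app n γ with x | x
    · show f₁.app m (extEnv ((Γ.sem S).res h γ) ((τ₁.sem S).res h x)) = _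
      rw [← res_extEnv, f₁.nat]; rfl
    · show f₂.app m (extEnv ((Γ.sem S).res h γ) ((τ₂.sem S).res h x)) = _
      rw [← res_extEnv, f₂.nat]; rfl

/-- The head of a stream. -/
def head (X : TreeObj.{v}) : TreeHom (stream X) X where
  app n s := s 0 (Nat.zero_le n)
  nat _ _ := rfl

theorem step_le_pred {m n : ℕ} : step m ≤ TimeWarp.pred (step n) ↔ m < n := by
  have h : TimeWarp.pred (step n) = (n : ℕ∞) := by
    show step n - 1 = (n : ℕ∞)
    unfold step
    norm_cast
  rw [h]
  unfold step
  norm_cast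

/-- The tail of a stream. -/
def tail (X : TreeObj.{v}) : TreeHom (stream X) (warp TimeWarp.pred (stream X)) where
  app n s := ⟨fun m hm k hk => X.res (m := m - k) (n := n - (k + 1))
      (by have := step_le_pred.1 hm; omega)
      (s (k + 1) (by have := step_le_pred.1 hm; omega)),
    fun k m h hm => by
      funext j hj
      exact (X.res_res _ _ _).symm⟩
  nat h s := by
    apply Subtype.ext
    funext m hm
    funext k hk
    exact X.res_res _ _ _

/-- The stream constructor. -/
def cons (X : TreeObj.{v}) : TreeHom (prod X (warp TimeWarp.pred (stream X))) (stream X) where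
  app n x := fun k => match k with
    | 0 => fun _ => x.1
    | k + 1 => fun hk => X.res (m := n - (k + 1)) (n := n - 1 - k) (by omega)
        (x.2.1 (n - 1) (step_le_pred.2 (by omega)) k (by omega))
  nat {m n} h x := by
    funext k hk
    cases k with
    | zero => rfl
    | succ k =>
      show X.res _ (x.2.1 (m - 1) _ k _) = X.res _ (X.res _ (x.2.1 (n - 1) _ k _))
      have e := x.2.2 (m - 1) (n - 1) (by omega) (step_le_pred.2 (by omega))
      rw [e, X.res_res, X.res_res]

/-- Underlying maps of the guarded fixpoint of `f : Γ × ∗_{-1} τ → τ`: at the first step nothing is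
known of the recursive value, afterwards its approximations at all previous steps are. -/
def fixApp (f : TreeHom ((Γ.ext (.warp TimeWarp.pred τ)).sem S) (τ.sem S)) :
    ∀ k, (Γ.sem S).obj k → (τ.sem S).obj k
  | 0, γ => f.app 0 (extEnv (τ := .warp TimeWarp.pred τ) γ
      ⟨fun _ hm => absurd (step_le_pred.1 hm) (Nat.not_lt_zero _),
        fun _ _ _ hm => absurd (step_le_pred.1 hm) (Nat.not_lt_zero _)⟩)
  | k + 1, γ => f.app (k + 1) (extEnv (τ := .warp TimeWarp.pred τ) γ
      ⟨fun _ hm => (τ.sem S).res (Nat.le_of_lt_succ (step_le_pred.1 hm))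
          (fixApp f k ((Γ.sem S).res (Nat.le_succ k) γ)),
        fun _ _ _ _ => ((τ.sem S).res_res _ _ _).symm⟩)

theorem fixApp_nat (f : TreeHom ((Γ.ext (.warp TimeWarp.pred τ)).sem S) (τ.sem S)) (n : ℕ) :
    ∀ (m : ℕ) (h : m ≤ n) (γ : (Γ.sem S).obj n),
      fixApp f m ((Γ.sem S).res h γ) = (τ.sem S).res h (fixApp f n γ) := by
  induction n with
  | zero =>
    intro m h γ
    obtain rfl := Nat.le_zero.1 h
    rw [(Γ.sem S).res_self, (τ.sem S).res_self]
  | succ n ih =>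
    intro m h γ
    refine Eq.trans ?_ (f.nat h _)
    refine Eq.trans ?_ (congrArg (f.app m) (res_extEnv h _ _).symm)
    cases m with
    | zero =>
      refine congrArg (fun z => f.app 0 (extEnv (τ := .warp TimeWarp.pred τ) _ z)) ?_
      apply Subtype.ext
      funext k hk
      exact absurd (step_le_pred.1 hk) (Nat.not_lt_zero _)
    | succ m =>
      refine congrArg (fun z => f.app (m + 1) (extEnv (τ := .warp TimeWarp.pred τ) _ z)) ?_
      apply Subtype.ext
      funext k hk
      show (τ.sem S).res _ (fixApp f m ((Γ.sem S).res _ ((Γ.sem S).res h γ))) =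
        (τ.sem S).res _ (fixApp f n ((Γ.sem S).res _ γ))
      have e := ih m (Nat.le_of_succ_le_succ h) ((Γ.sem S).res (Nat.le_succ n) γ)
      rw [(Γ.sem S).res_res] at e ⊢
      rw [e, (τ.sem S).res_res]

/-- Guarded fixpoints. -/
def fix (f : TreeHom ((Γ.ext (.warp TimeWarp.pred τ)).sem S) (τ.sem S)) :
    TreeHom (Γ.sem S) (τ.sem S) :=
  ⟨fixApp f, fun h γ => fixApp_nat f _ _ h γ⟩

/-- The canonical morphism from the interpretation of `∗_p Γ` to the warping of that of `Γ`. -/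
def warpCtx (S : G → Type v) (p : TimeWarp) (Γ : Ctx G n) :
    TreeHom ((Γ.warp p).sem S) (TreeObj.warp p (Γ.sem S)) where
  app k γ := ⟨fun m hm i => (show (TreeObj.warp p ((Γ i).sem S)).obj k from γ i).1 m hm,
    fun k m h hm => by
      funext i
      exact (γ i).2 k m h hm⟩
  nat _ _ := rfl

/-- The interpretation of context coercions. -/
def mapCtx {Γ Γ' : Ctx G n} (b : ∀ i, TreeHom ((Γ i).sem S) ((Γ' i).sem S)) :
    TreeHom (Γ.sem S) (Γ'.sem S) where
  app k γ := fun i => (b i).app k (γ i)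
  nat h γ := by
    funext i
    exact (b i).nat h (γ i)

/-- The interpretation of structure maps. -/
def reindex {m : ℕ} (S : G → Type v) (Γ' : Ctx G m) (σ : Fin n → Fin m) :
    TreeHom (Γ'.sem S) (Ctx.sem S fun i => Γ' (σ i)) :=
  ⟨fun _ γ i => γ (σ i), fun _ _ => rfl⟩

end TreeHom

end Terms

/-- The interpretation of typing derivations. -/
def Typing.sem {G : Type u} {S : G → Type v} :
    {n : ℕ} → {Γ : Ctx G n} → {e : Tm G S n} → {τ : Ty G} →
      Typing Γ e τ → TreeHom (Γ.sem S) (τ.sem S)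
  | _, Γ, _, _, .var i => TreeHom.lookup S Γ i
  | _, _, _, _, .lam d => TreeHom.curry d.sem
  | _, _, _, _, .app d₁ d₂ => TreeHom.apply d₁.sem d₂.sem
  | _, _, _, _, .pair d₁ d₂ => TreeHom.pair d₁.sem d₂.sem
  | _, _, _, _, .proj₁ d => TreeHom.comp d.sem (TreeHom.fst _ _)
  | _, _, _, _, .proj₂ d => TreeHom.comp d.sem (TreeHom.snd _ _)
  | _, _, _, _, .inj₁ d => TreeHom.comp d.sem (TreeHom.inl _ _)
  | _, _, _, _, .inj₂ d => TreeHom.comp d.sem (TreeHom.inr _ _)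
  | _, _, _, _, .case d d₁ d₂ => TreeHom.cases d.sem d₁.sem d₂.sem
  | _, _, _, _, .head d => TreeHom.comp d.sem (TreeHom.head _)
  | _, _, _, _, .tail d => TreeHom.comp d.sem (TreeHom.tail _)
  | _, _, _, _, .cons d₁ d₂ => TreeHom.comp (TreeHom.pair d₁.sem d₂.sem) (TreeHom.cons _)
  | _, _, _, _, .const _ s => ⟨fun _ _ => s, fun _ _ => rfl⟩
  | _, _, _, _, .fix d => TreeHom.fix d.sem
  | _, _, _, _, .by_ (Γ := Γ) p d => (TreeHom.warpCtx S p Γ).comp (TreeHom.warpMap p d.sem)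
  | _, _, _, _, .subR d a => TreeHom.comp d.sem (a.sem S)
  | _, _, _, _, .subL b d => TreeHom.comp (TreeHom.mapCtx fun i => (b i).sem S) d.sem
  | _, Γ', _, _, .struct σ d => (TreeHom.reindex S Γ' σ).comp d.sem

/-- Semantic equality of explicit terms `Γ ⊢ e₁ ≅ e₂ : τ`: both terms have type `τ` in `Γ`, and they
have the same interpretation, whichever typing derivations are used to compute it. -/
def SemEq {G : Type u} {S : G → Type v} {n : ℕ} (Γ : Ctx G n) (e₁ e₂ : Tm G S n) (τ : Ty G) :
    Prop :=
  HasType Γ e₁ τ ∧ HasType Γ e₂ τ ∧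
    ∀ (d₁ : Typing Γ e₁ τ) (d₂ : Typing Γ e₂ τ), d₁.sem = d₂.sem

end

end WarpCalc

open WarpCalc

namespace WarpCalc

/-! ### Time warps -/

namespace TimeWarp

-- Two principles carry the theorem: coercions are coherent, and elaboration produces a least type.
--
-- Coherence of subtyping. Every type is isomorphic, through `nfIso`, to its normal form. Between
-- normal forms the only coercions that matter are built from delays, and between two given types
-- there is at most one such morphism (`Prec.unique`). Call a morphism from `τ` to `τ'` coherent
-- (`Coh`) if conjugation by the normal form isomorphisms turns it into this morphism. Coherent
-- morphisms are unique, compose, and contain the interpretation of every coercion (`Sub.coh`). So a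
-- coercion is determined semantically by its endpoints, and `coerce` succeeds whenever a coherent
-- morphism exists, its result denoting that morphism (`Coh.coerce_eq`).
--
-- Least types. A coherent morphism into a product, sum, arrow or stream factors through the type
-- that elaboration reads off the normal form of the source (`Coh.prod_inv` and its analogues).
-- Partial suprema are least upper bounds (`Coh.exists_sup`), and division is adjoint to warping
-- (`Coh.exists_div`, `Coh.div_inv`). These universal properties are what each typing rule needs in
-- order to be mimicked by elaboration.
--
-- Completeness is then an induction on typing derivations, `Typing.exists_elaboration`. The
-- statement must be generalized from `Γ` to every context `Γ'` that maps coherently to `Γ` after a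
-- renaming. Context coercions and structure maps vanish under erasure, so they have to be absorbed
-- in this hypothesis; moreover elaboration types the branches of a case, and the body of a warped
-- term, in contexts more precise than those of the given derivation. The conclusion factors the
-- interpretation of the derivation as the elaborated one followed by a coherent morphism.
--
-- As elaboration is a function, its type and its morphism depend on the erasure only. Any two
-- derivations of terms with equal erasures therefore agree (`Typing.coherence`), and this gives the
-- semantic equality for all derivations at once.

theorem mul_assoc (p q r : TimeWarp) : (p.mul q).mul r = p.mul (q.mul r) := rfl

theorem mul_le_mul {p p' q q' : TimeWarp} (h : p ≤ p') (h' : q ≤ q') : p.mul q ≤ p'.mul q' :=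
  fun n => (OrderHomClass.mono q (h n)).trans (h' (p' n))

theorem omega_apply (n : ℕ∞) : omega n = if n = 0 then 0 else ⊤ := rfl

theorem le_omega (p : TimeWarp) : p ≤ omega := fun n => by
  show p n ≤ omega n
  rw [omega_apply]
  split_ifs with h
  · rw [h]
    exact (map_bot p).le
  · exact le_top

theorem omega_mul_omega : omega.mul omega = omega := by
  apply le_antisymm (le_omega _)
  intro n
  show omega n ≤ omega (omega n)
  simp only [omega_apply]
  split_ifs <;> simp_all

theorem le_mul_omega (p : TimeWarp) : p ≤ p.mul omega :=
  mul_le_mul le_rfl (q := one) (le_omega _)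

/-- The value of `p.mul r` at `n` is that of `r` at `p n`. Since the division is a pointwise
supremum of admissible warps, evaluation at `p n` shows that it is admissible itself. -/
theorem le_div_iff {p q r : TimeWarp} : r ≤ q.div p ↔ p.mul r ≤ q := by
  constructor
  · intro h n
    refine (h (p n)).trans (iSup_le fun s => s.2 n)
  · intro h n
    exact le_iSup (fun s : {s : TimeWarp // mul p s ≤ q} => s.1 n) ⟨r, h⟩

/-- Warps fixed by right multiplication by `omega` are the ones that stand before ground types in
normal forms. This closure property, and those for `inf` and `sup`, keep types normal under
division, suprema and infima. -/
theorem div_mul_omega {p q : TimeWarp} (h : q.mul omega = q) :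
    (q.div p).mul omega = q.div p := by
  apply le_antisymm _ (le_mul_omega _)
  rw [le_div_iff, ← mul_assoc]
  calc _ ≤ q.mul omega := mul_le_mul (le_div_iff.1 le_rfl) le_rfl
    _ = q := h

theorem inf_le_left (p q : TimeWarp) : p.inf q ≤ p := fun _ => _root_.inf_le_left

theorem inf_le_right (p q : TimeWarp) : p.inf q ≤ q := fun _ => _root_.inf_le_right

theorem le_inf {p q r : TimeWarp} (h : r ≤ p) (h' : r ≤ q) : r ≤ p.inf q :=
  fun n => _root_.le_inf (h n) (h' n)

theorem le_sup_left (p q : TimeWarp) : p ≤ p.sup q := fun _ => _root_.le_sup_left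

theorem le_sup_right (p q : TimeWarp) : q ≤ p.sup q := fun _ => _root_.le_sup_right

theorem sup_le {p q r : TimeWarp} (h : p ≤ r) (h' : q ≤ r) : p.sup q ≤ r :=
  fun n => _root_.sup_le (h n) (h' n)

theorem inf_mul_omega {p q : TimeWarp} (hp : p.mul omega = p) (hq : q.mul omega = q) :
    (p.inf q).mul omega = p.inf q := by
  apply le_antisymm _ (le_mul_omega _)
  apply le_inf
  · calc _ ≤ p.mul omega := mul_le_mul (inf_le_left _ _) le_rfl
      _ = p := hp
  · calc _ ≤ q.mul omega := mul_le_mul (inf_le_right _ _) le_rfl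
      _ = q := hq

theorem sup_mul_omega {p q : TimeWarp} (hp : p.mul omega = p) (hq : q.mul omega = q) :
    (p.sup q).mul omega = p.sup q := by
  apply le_antisymm _ (le_mul_omega _)
  intro n
  have hpn : omega (p n) = p n := DFunLike.congr_fun hp n
  have hqn : omega (q n) = q n := DFunLike.congr_fun hq n
  show omega (p n ⊔ q n) ≤ p n ⊔ q n
  -- By linearity the supremum at `n` is one of the two values, and `omega` fixes both.
  rcases le_total (p n) (q n) with h | h
  · rw [sup_eq_right.2 h, hqn]
  · rw [sup_eq_left.2 h, hpn]

end TimeWarp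

/-! ### Isomorphisms of the topos of trees -/

theorem TreeHom.ext_app {X Y : TreeObj.{v}} {f g : TreeHom X Y}
    (h : ∀ n x, f.app n x = g.app n x) : f = g :=
  TreeHom.ext (funext fun n => funext fun x => h n x)

/-- Isomorphisms in the topos of trees. -/
structure TreeIso (X Y : TreeObj.{v}) where
  hom : TreeHom X Y
  inv : TreeHom Y X
  hom_inv : hom.comp inv = TreeHom.id X
  inv_hom : inv.comp hom = TreeHom.id Y

namespace TreeIso

variable {X Y Z X' Y' : TreeObj.{v}}

theorem hom_inv_app (i : TreeIso X Y) (n : ℕ) (x : X.obj n) :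
    i.inv.app n (i.hom.app n x) = x := by
  have := congrArg (fun f => TreeHom.app f n x) i.hom_inv
  exact this

theorem inv_hom_app (i : TreeIso X Y) (n : ℕ) (x : Y.obj n) :
    i.hom.app n (i.inv.app n x) = x := by
  have := congrArg (fun f => TreeHom.app f n x) i.inv_hom
  exact this

/-- The identity isomorphism. -/
def refl (X : TreeObj.{v}) : TreeIso X X := ⟨TreeHom.id X, TreeHom.id X, rfl, rfl⟩

/-- Composition of isomorphisms. -/
def trans (i : TreeIso X Y) (j : TreeIso Y Z) : TreeIso X Z where
  hom := i.hom.comp j.hom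
  inv := j.inv.comp i.inv
  hom_inv := TreeHom.ext_app fun n x => by simp [TreeHom.comp, hom_inv_app, TreeHom.id]
  inv_hom := TreeHom.ext_app fun n x => by simp [TreeHom.comp, inv_hom_app, TreeHom.id]

/-- Functorial action of streams on isomorphisms. -/
def stream (i : TreeIso X Y) : TreeIso (TreeObj.stream X) (TreeObj.stream Y) where
  hom := i.hom.streamMap
  inv := i.inv.streamMap
  hom_inv := TreeHom.ext_app fun _ s => funext fun k => funext fun hk => i.hom_inv_app _ (s k hk)
  inv_hom := TreeHom.ext_app fun _ s => funext fun k => funext fun hk => i.inv_hom_app _ (s k hk)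

/-- Functorial action of exponentials on isomorphisms. -/
def exp (i : TreeIso X X') (j : TreeIso Y Y') : TreeIso (TreeObj.exp X Y) (TreeObj.exp X' Y') where
  hom := TreeHom.expMap i.inv j.hom
  inv := TreeHom.expMap i.hom j.inv
  hom_inv := TreeHom.ext_app fun _ φ => Subtype.ext <| funext fun m => funext fun hm =>
    funext fun x => by
      show j.inv.app m (j.hom.app m (φ.1 m hm (i.inv.app m (i.hom.app m x)))) = φ.1 m hm x
      rw [j.hom_inv_app, i.hom_inv_app]
  inv_hom := TreeHom.ext_app fun _ φ => Subtype.ext <| funext fun m => funext fun hm =>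
    funext fun x => by
      show j.hom.app m (j.inv.app m (φ.1 m hm (i.hom.app m (i.inv.app m x)))) = φ.1 m hm x
      rw [j.inv_hom_app, i.inv_hom_app]

/-- Functorial action of products on isomorphisms. -/
def prod (i : TreeIso X X') (j : TreeIso Y Y') :
    TreeIso (TreeObj.prod X Y) (TreeObj.prod X' Y') where
  hom := TreeHom.prodMap i.hom j.hom
  inv := TreeHom.prodMap i.inv j.inv
  hom_inv := TreeHom.ext_app fun n x => Prod.ext (i.hom_inv_app n x.1) (j.hom_inv_app n x.2)
  inv_hom := TreeHom.ext_app fun n x => Prod.ext (i.inv_hom_app n x.1) (j.inv_hom_app n x.2)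

/-- Functorial action of coproducts on isomorphisms. -/
def sum (i : TreeIso X X') (j : TreeIso Y Y') :
    TreeIso (TreeObj.sum X Y) (TreeObj.sum X' Y') where
  hom := TreeHom.sumMap i.hom j.hom
  inv := TreeHom.sumMap i.inv j.inv
  hom_inv := TreeHom.ext_app fun n x => by
    rcases x with x | x
    · exact congrArg Sum.inl (i.hom_inv_app n x)
    · exact congrArg Sum.inr (j.hom_inv_app n x)
  inv_hom := TreeHom.ext_app fun n x => by
    rcases x with x | x
    · exact congrArg Sum.inl (i.inv_hom_app n x)
    · exact congrArg Sum.inr (j.inv_hom_app n x)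

/-- Functorial action of warping on isomorphisms. -/
def warp (p : TimeWarp) (i : TreeIso X Y) : TreeIso (TreeObj.warp p X) (TreeObj.warp p Y) where
  hom := TreeHom.warpMap p i.hom
  inv := TreeHom.warpMap p i.inv
  hom_inv := TreeHom.ext_app fun _ x => Subtype.ext <| funext fun m => funext fun hm =>
    i.hom_inv_app m (x.1 m hm)
  inv_hom := TreeHom.ext_app fun _ x => Subtype.ext <| funext fun m => funext fun hm =>
    i.inv_hom_app m (x.1 m hm)

/-- Warping by the identity. -/
noncomputable def wrap (X : TreeObj.{v}) : TreeIso X (TreeObj.warp TimeWarp.one X) where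
  hom := TreeHom.wrap X
  inv := TreeHom.unwrap X
  hom_inv := TreeHom.ext_app fun _ x => X.res_self _ x
  inv_hom := TreeHom.ext_app fun n x => Subtype.ext <| funext fun m => funext fun _ =>
    (x.2 m n _ le_rfl).symm

/-- Iterated warping. -/
noncomputable def concat (p q : TimeWarp) (X : TreeObj.{v}) :
    TreeIso (TreeObj.warp p (TreeObj.warp q X)) (TreeObj.warp (p.mul q) X) where
  hom := TreeHom.concat p q X
  inv := TreeHom.decat p q X
  hom_inv := TreeHom.ext_app fun _ x => Subtype.ext <| funext fun _ => funext fun hm =>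
    Subtype.ext <| funext fun _ => funext fun hk => TreeHom.warp_warp_indep x _ hm _ hk
  inv_hom := rfl

/-- Warping of constant presheaves. -/
noncomputable def inflate (A : Type v) :
    TreeIso (TreeObj.const A) (TreeObj.warp TimeWarp.omega (TreeObj.const A)) where
  hom := TreeHom.inflate A
  inv := (TreeHom.delay (TimeWarp.le_omega TimeWarp.one) _).comp (TreeHom.unwrap _)
  hom_inv := rfl
  inv_hom := TreeHom.ext_app fun n x => Subtype.ext <| funext fun m => funext fun hm => by
    -- Restriction in a constant presheaf is the identity, so compatibility forces all components to
    -- coincide.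
    rcases le_total m n with h | h
    · exact (x.2 m n h _).symm
    · exact x.2 n m h hm

/-- Distributivity of warping over products. -/
def dist (p : TimeWarp) (X Y : TreeObj.{v}) :
    TreeIso (TreeObj.warp p (TreeObj.prod X Y))
      (TreeObj.prod (TreeObj.warp p X) (TreeObj.warp p Y)) :=
  ⟨TreeHom.dist p X Y, TreeHom.fact p X Y, rfl, rfl⟩

end TreeIso

variable {G : Type u} {S : G → Type v}

/-- The isomorphism from `∗_p τ` to `τ.push p`. -/
noncomputable def pushIso (S : G → Type v) (p : TimeWarp) :
    ∀ τ : Ty G, TreeIso (TreeObj.warp p (τ.sem S)) ((τ.push p).sem S)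
  | .prod τ₁ τ₂ => (TreeIso.dist p _ _).trans ((pushIso S p τ₁).prod (pushIso S p τ₂))
  | .warp q τ => TreeIso.concat p q (τ.sem S)
  | .ground _ => TreeIso.refl _
  | .stream _ => TreeIso.refl _
  | .arrow _ _ => TreeIso.refl _
  | .sum _ _ => TreeIso.refl _

/-- The isomorphism from a type to its normal form. -/
noncomputable def nfIso (S : G → Type v) :
    ∀ τ : Ty G, TreeIso (τ.sem S) (τ.normal.sem S)
  | .ground ν => TreeIso.inflate (S ν)
  | .stream τ => (nfIso S τ).stream.trans (TreeIso.wrap _)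
  | .arrow τ₁ τ₂ => ((nfIso S τ₁).exp (nfIso S τ₂)).trans (TreeIso.wrap _)
  | .prod τ₁ τ₂ => (nfIso S τ₁).prod (nfIso S τ₂)
  | .sum τ₁ τ₂ => ((nfIso S τ₁).sum (nfIso S τ₂)).trans (TreeIso.wrap _)
  | .warp p τ => ((nfIso S τ).warp p).trans (pushIso S p τ.normal)

/-! ### Precedence and its interpretation -/

/-- `Prec τ τ' f`: the type `τ` precedes `τ'`, and `f` is the morphism made of delays that
witnesses this. -/
inductive Prec (S : G → Type v) :
    (τ τ' : Ty G) → TreeHom (τ.sem S) (τ'.sem S) → Prop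
  | ground (ν : G) : Prec S (.ground ν) (.ground ν) (TreeHom.id _)
  | stream {τ τ' : Ty G} {f : TreeHom (τ.sem S) (τ'.sem S)} :
      Prec S τ τ' f → Prec S (.stream τ) (.stream τ') f.streamMap
  | arrow {τ₁ τ₁' τ₂ τ₂' : Ty G} {f : TreeHom (τ₁'.sem S) (τ₁.sem S)}
      {g : TreeHom (τ₂.sem S) (τ₂'.sem S)} :
      Prec S τ₁' τ₁ f → Prec S τ₂ τ₂' g →
        Prec S (.arrow τ₁ τ₂) (.arrow τ₁' τ₂') (TreeHom.expMap f g)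
  | prod {τ₁ τ₁' τ₂ τ₂' : Ty G} {f : TreeHom (τ₁.sem S) (τ₁'.sem S)}
      {g : TreeHom (τ₂.sem S) (τ₂'.sem S)} :
      Prec S τ₁ τ₁' f → Prec S τ₂ τ₂' g →
        Prec S (.prod τ₁ τ₂) (.prod τ₁' τ₂') (TreeHom.prodMap f g)
  | sum {τ₁ τ₁' τ₂ τ₂' : Ty G} {f : TreeHom (τ₁.sem S) (τ₁'.sem S)}
      {g : TreeHom (τ₂.sem S) (τ₂'.sem S)} :
      Prec S τ₁ τ₁' f → Prec S τ₂ τ₂' g →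
        Prec S (.sum τ₁ τ₂) (.sum τ₁' τ₂') (TreeHom.sumMap f g)
  | warp {p q : TimeWarp} {τ τ' : Ty G} {f : TreeHom (τ.sem S) (τ'.sem S)} (h : q ≤ p) :
      Prec S τ τ' f → Prec S (.warp p τ) (.warp q τ')
        ((TreeHom.delay h _).comp (TreeHom.warpMap q f))

theorem TreeHom.sumMap_id (X Y : TreeObj.{v}) :
    TreeHom.sumMap (TreeHom.id X) (TreeHom.id Y) = TreeHom.id _ :=
  TreeHom.ext_app fun _ x => by rcases x with x | x <;> rfl

theorem TreeHom.sumMap_comp {X Y Z X' Y' Z' : TreeObj.{v}} (f : TreeHom X Y) (g : TreeHom Y Z)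
    (f' : TreeHom X' Y') (g' : TreeHom Y' Z') :
    TreeHom.sumMap (f.comp g) (f'.comp g') = (TreeHom.sumMap f f').comp (TreeHom.sumMap g g') :=
  TreeHom.ext_app fun _ x => by rcases x with x | x <;> rfl

namespace Prec

theorem refl (S : G → Type v) (τ : Ty G) : Prec S τ τ (TreeHom.id _) := by
  induction τ with
  | ground ν => exact .ground ν
  | stream τ ih => exact .stream ih
  | arrow τ₁ τ₂ ih₁ ih₂ => exact .arrow ih₁ ih₂
  | prod τ₁ τ₂ ih₁ ih₂ => exact .prod ih₁ ih₂
  -- Functoriality of coproducts needs a case analysis, whereas the functor laws of the other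
  -- constructors hold by definition; hence the transport.
  | sum τ₁ τ₂ ih₁ ih₂ => exact TreeHom.sumMap_id (τ₁.sem S) (τ₂.sem S) ▸ Prec.sum ih₁ ih₂
  | warp p τ ih => exact .warp le_rfl ih

theorem trans {τ₁ τ₂ τ₃ : Ty G} {f : TreeHom (τ₁.sem S) (τ₂.sem S)}
    {g : TreeHom (τ₂.sem S) (τ₃.sem S)} (hf : Prec S τ₁ τ₂ f) (hg : Prec S τ₂ τ₃ g) :
    Prec S τ₁ τ₃ (f.comp g) := by
  induction τ₂ generalizing τ₁ τ₃ with
  | ground ν => cases hf; cases hg; exact .ground ν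
  | stream τ ih => cases hf with | stream hf => cases hg with | stream hg => exact .stream (ih hf hg)
  | arrow σ₁ σ₂ ih₁ ih₂ =>
    cases hf with | arrow hf hf' => cases hg with | arrow hg hg' =>
    exact .arrow (ih₁ hg hf) (ih₂ hf' hg')
  | prod σ₁ σ₂ ih₁ ih₂ =>
    cases hf with | prod hf hf' => cases hg with | prod hg hg' =>
    exact .prod (ih₁ hf hg) (ih₂ hf' hg')
  | sum σ₁ σ₂ ih₁ ih₂ =>
    cases hf with | sum hf hf' => cases hg with | sum hg hg' =>
    exact TreeHom.sumMap_comp _ _ _ _ ▸ Prec.sum (ih₁ hf hg) (ih₂ hf' hg')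
  | warp p τ ih =>
    cases hf with | warp h hf => cases hg with | warp h' hg =>
    exact .warp (h'.trans h) (ih hf hg)

/-- Delays leave no choice: the head constructors of the two types determine the rule, and a delay
depends on its two warps only. All coherence results rest on this. -/
theorem unique {τ τ' : Ty G} {f g : TreeHom (τ.sem S) (τ'.sem S)}
    (hf : Prec S τ τ' f) (hg : Prec S τ τ' g) : f = g := by
  induction hf with
  | ground ν => cases hg; rfl
  | stream _ ih => cases hg with | stream hg => rw [ih hg]
  | arrow _ _ ih₁ ih₂ => cases hg with | arrow hg hg' => rw [ih₁ hg, ih₂ hg']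
  | prod _ _ ih₁ ih₂ => cases hg with | prod hg hg' => rw [ih₁ hg, ih₂ hg']
  | sum _ _ ih₁ ih₂ => cases hg with | sum hg hg' => rw [ih₁ hg, ih₂ hg']
  | warp h _ ih => cases hg with | warp h' hg => rw [ih hg]

/-- Normalized warping preserves precedence. -/
theorem push {p q : TimeWarp} (h : q ≤ p) {τ τ' : Ty G} {f : TreeHom (τ.sem S) (τ'.sem S)}
    (hf : Prec S τ τ' f) :
    ∃ g, Prec S (τ.push p) (τ'.push q) g ∧
      ((TreeHom.delay h _).comp (TreeHom.warpMap q f)).comp (pushIso S q τ').hom =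
        (pushIso S p τ).hom.comp g := by
  induction hf with
  | ground ν => exact ⟨_, .warp h (.ground ν), rfl⟩
  | stream hf => exact ⟨_, .warp h (.stream hf), rfl⟩
  | arrow hf hg => exact ⟨_, .warp h (.arrow hf hg), rfl⟩
  | sum hf hg => exact ⟨_, .warp h (.sum hf hg), rfl⟩
  | prod _ _ ih₁ ih₂ =>
    obtain ⟨g₁, hg₁, e₁⟩ := ih₁
    obtain ⟨g₂, hg₂, e₂⟩ := ih₂
    refine ⟨_, .prod hg₁ hg₂, TreeHom.ext_app fun n x => Prod.ext ?_ ?_⟩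
    · exact congrArg (fun k => TreeHom.app k n ((TreeHom.dist p _ _).app n x).1) e₁
    · exact congrArg (fun k => TreeHom.app k n ((TreeHom.dist p _ _).app n x).2) e₂
  | @warp r s τ τ' f h' hf =>
    refine ⟨_, .warp (TimeWarp.mul_le_mul h h') hf, TreeHom.ext_app fun n x => Subtype.ext <|
      funext fun m => funext fun hm => ?_⟩
    -- Both sides read the same doubly indexed family at `m`, through possibly different
    -- intermediate steps, on which the value does not depend.
    exact congrArg (f.app m) (TreeHom.warp_warp_indep x _ _ _ _)

/-- Associativity of concatenation. The two pushed types are equal, but not definitionally for a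
variable `τ`; the comparison by a precedence morphism replaces a transport along that equality. -/
theorem push_push (p q : TimeWarp) (τ : Ty G) :
    ∃ g, Prec S ((τ.push q).push p) (τ.push (p.mul q)) g ∧
      (TreeHom.concat p q (τ.sem S)).comp (pushIso S (p.mul q) τ).hom =
        ((TreeHom.warpMap p (pushIso S q τ).hom).comp (pushIso S p (τ.push q)).hom).comp g := by
  induction τ with
  | ground ν => exact ⟨_, refl S _, rfl⟩
  | stream τ => exact ⟨_, refl S _, rfl⟩
  | arrow τ₁ τ₂ => exact ⟨_, refl S _, rfl⟩
  | sum τ₁ τ₂ => exact ⟨_, refl S _, rfl⟩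
  | prod τ₁ τ₂ ih₁ ih₂ =>
    obtain ⟨g₁, hg₁, e₁⟩ := ih₁
    obtain ⟨g₂, hg₂, e₂⟩ := ih₂
    refine ⟨_, .prod hg₁ hg₂, TreeHom.ext_app fun n x => Prod.ext ?_ ?_⟩
    · exact congrArg (fun k => TreeHom.app k n
        ((TreeHom.dist p _ _).app n ((TreeHom.warpMap p (TreeHom.dist q _ _)).app n x)).1) e₁
    · exact congrArg (fun k => TreeHom.app k n
        ((TreeHom.dist p _ _).app n ((TreeHom.warpMap p (TreeHom.dist q _ _)).app n x)).2) e₂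
  | warp r τ =>
    refine ⟨_, refl S _, TreeHom.ext_app fun n x => Subtype.ext <|
      funext fun m => funext fun hm => ?_⟩
    -- Each side reads the triply indexed family at its own pair of intermediate steps. Both are
    -- compared with the value at one common pair `k`, `l`.
    obtain ⟨k, hk, hk'⟩ := TreeHom.exists_step (p := p) (q := q.mul r) hm
    obtain ⟨l, hl, hl'⟩ := TreeHom.exists_step (p := q) (q := r) hk'
    trans ((x.1 k hk).1 l hl).1 m hl'
    · refine (TreeHom.warp_warp_indep ((TreeHom.concat p q _).app n x) _
        (hl.trans (OrderHomClass.mono q hk)) _ hl').trans ?_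
      exact congrArg (fun y => y.1 m hl') (TreeHom.warp_warp_indep x _ _ _ _)
    · symm
      refine (TreeHom.warp_warp_indep ((TreeHom.warpMap p (TreeHom.concat q r _)).app n x) _
        hk (TreeHom.exists_step (p := p) (q := q.mul r) hm).choose_spec.2 hk').trans ?_
      exact TreeHom.warp_warp_indep (x.1 k hk) _ _ _ _

end Prec

-- Coherence of coercions

/-- The morphism from `τ` to `τ'` that every coercion from `τ` to `τ'` denotes. -/
def Coh (S : G → Type v) (τ τ' : Ty G) (f : TreeHom (τ.sem S) (τ'.sem S)) : Prop :=
  ∃ g, Prec S τ.normal τ'.normal g ∧ f.comp (nfIso S τ').hom = (nfIso S τ).hom.comp g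

theorem TreeHom.congr_app {X Y : TreeObj.{v}} {f g : TreeHom X Y} (h : f = g) {n : ℕ}
    (x : X.obj n) : f.app n x = g.app n x := by rw [h]

namespace Coh

/-- The precedence morphism of the normal forms is unique, and the isomorphism of `τ'` with its
normal form can be cancelled. -/
theorem unique {τ τ' : Ty G} {f g : TreeHom (τ.sem S) (τ'.sem S)}
    (hf : Coh S τ τ' f) (hg : Coh S τ τ' g) : f = g := by
  obtain ⟨f', hf', ef⟩ := hf
  obtain ⟨g', hg', eg⟩ := hg
  rw [← hf'.unique hg', ← ef] at eg
  refine TreeHom.ext_app fun n x => ?_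
  have := congrArg ((nfIso S τ').inv.app n) (TreeHom.congr_app eg x)
  simp only [TreeHom.comp, TreeIso.hom_inv_app] at this
  exact this.symm

theorem exists_of_prec {τ τ' : Ty G} {g : TreeHom (τ.normal.sem S) (τ'.normal.sem S)}
    (hg : Prec S τ.normal τ'.normal g) : ∃ f, Coh S τ τ' f := by
  refine ⟨((nfIso S τ).hom.comp g).comp (nfIso S τ').inv, g, hg, TreeHom.ext_app fun n x => ?_⟩
  simp only [TreeHom.comp, TreeIso.inv_hom_app]

theorem refl (S : G → Type v) (τ : Ty G) : Coh S τ τ (TreeHom.id _) :=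
  ⟨_, Prec.refl S _, rfl⟩

theorem trans {τ₁ τ₂ τ₃ : Ty G} {f : TreeHom (τ₁.sem S) (τ₂.sem S)}
    {g : TreeHom (τ₂.sem S) (τ₃.sem S)} (hf : Coh S τ₁ τ₂ f) (hg : Coh S τ₂ τ₃ g) :
    Coh S τ₁ τ₃ (f.comp g) := by
  obtain ⟨f', hf', ef⟩ := hf
  obtain ⟨g', hg', eg⟩ := hg
  refine ⟨_, hf'.trans hg', TreeHom.ext_app fun n x => ?_⟩
  have e₁ := TreeHom.congr_app eg (f.app n x)
  have e₂ := congrArg (g'.app n) (TreeHom.congr_app ef x)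
  exact e₁.trans e₂

/-- Morphisms inverse to a coercion between types of the same normal form. -/
theorem symm {τ τ' : Ty G} {i : TreeIso (τ.sem S) (τ'.sem S)} (hi : Coh S τ τ' i.hom)
    (h : τ'.normal = τ.normal) : Coh S τ' τ i.inv := by
  obtain ⟨g, hg⟩ : ∃ g, Prec S τ'.normal τ.normal g := by
    rw [h]
    exact ⟨_, Prec.refl S _⟩
  obtain ⟨f, hf⟩ := exists_of_prec hg
  -- A coherent endomorphism is the identity by uniqueness. So `f` is a one-sided inverse of an
  -- isomorphism, hence its inverse.
  have e : f.comp i.hom = TreeHom.id _ := (hf.trans hi).unique (refl S _)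
  have : i.inv = f := TreeHom.ext_app fun n x => by
    have e' := congrArg (i.inv.app n) (TreeHom.congr_app e x)
    simp only [TreeHom.comp, TreeIso.hom_inv_app] at e'
    exact e'.symm
  rw [this]
  exact hf

theorem prod {τ₁ τ₁' τ₂ τ₂' : Ty G} {f : TreeHom (τ₁.sem S) (τ₁'.sem S)}
    {g : TreeHom (τ₂.sem S) (τ₂'.sem S)} (hf : Coh S τ₁ τ₁' f) (hg : Coh S τ₂ τ₂' g) :
    Coh S (.prod τ₁ τ₂) (.prod τ₁' τ₂') (TreeHom.prodMap f g) := by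
  obtain ⟨f', hf', ef⟩ := hf
  obtain ⟨g', hg', eg⟩ := hg
  exact ⟨_, .prod hf' hg', TreeHom.ext_app fun n x =>
    Prod.ext (TreeHom.congr_app ef x.1) (TreeHom.congr_app eg x.2)⟩

/-- Naturality of wrapping. Normal forms of streams, arrows and sums begin with a warp by the
identity, and this removes it from the coherence squares of these constructors. -/
theorem wrap_nat {X Y X' Y' : TreeObj.{v}} {f : TreeHom X Y} {a : TreeHom Y Y'} {b : TreeHom X X'}
    {f' : TreeHom X' Y'} (e : f.comp a = b.comp f') :
    f.comp (a.comp (TreeHom.wrap _)) = (b.comp (TreeHom.wrap _)).comp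
      ((TreeHom.delay le_rfl _).comp (TreeHom.warpMap TimeWarp.one f')) :=
  TreeHom.ext_app fun _ x => Subtype.ext <| funext fun _ => funext fun _ =>
    (congrArg (Y'.res _) (TreeHom.congr_app e x)).trans (f'.nat _ _).symm

theorem stream {τ τ' : Ty G} {f : TreeHom (τ.sem S) (τ'.sem S)} (hf : Coh S τ τ' f) :
    Coh S (.stream τ) (.stream τ') f.streamMap := by
  obtain ⟨g, hg, e⟩ := hf
  exact ⟨_, .warp le_rfl (.stream hg), wrap_nat <| TreeHom.ext_app fun n x =>
    funext fun k => funext fun hk => TreeHom.congr_app e (x k hk)⟩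

theorem sum {τ₁ τ₁' τ₂ τ₂' : Ty G} {f : TreeHom (τ₁.sem S) (τ₁'.sem S)}
    {g : TreeHom (τ₂.sem S) (τ₂'.sem S)} (hf : Coh S τ₁ τ₁' f) (hg : Coh S τ₂ τ₂' g) :
    Coh S (.sum τ₁ τ₂) (.sum τ₁' τ₂') (TreeHom.sumMap f g) := by
  obtain ⟨f', hf', ef⟩ := hf
  obtain ⟨g', hg', eg⟩ := hg
  refine ⟨_, .warp le_rfl (.sum hf' hg'), wrap_nat ?_⟩
  refine TreeHom.ext_app fun n x => ?_
  rcases x with x | x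
  · exact congrArg Sum.inl (TreeHom.congr_app ef x)
  · exact congrArg Sum.inr (TreeHom.congr_app eg x)

theorem arrow {τ₁ τ₁' τ₂ τ₂' : Ty G} {f : TreeHom (τ₁'.sem S) (τ₁.sem S)}
    {g : TreeHom (τ₂.sem S) (τ₂'.sem S)} (hf : Coh S τ₁' τ₁ f) (hg : Coh S τ₂ τ₂' g) :
    Coh S (.arrow τ₁ τ₂) (.arrow τ₁' τ₂') (TreeHom.expMap f g) := by
  obtain ⟨f', hf', ef⟩ := hf
  obtain ⟨g', hg', eg⟩ := hg
  refine ⟨_, .warp le_rfl (.arrow hf' hg'), wrap_nat ?_⟩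
  refine TreeHom.ext_app fun n x => Subtype.ext <| funext fun m => funext fun hm =>
    funext fun y => ?_
  refine (TreeHom.congr_app eg _).trans ?_
  show g'.app m ((nfIso S τ₂).hom.app m (x.1 m hm (f.app m ((nfIso S τ₁').inv.app m y)))) =
    g'.app m ((nfIso S τ₂).hom.app m (x.1 m hm ((nfIso S τ₁).inv.app m (f'.app m y))))
  -- In the contravariant position the normal form isomorphisms occur inverted. The square for `f`
  -- has to be turned around by applying it to a preimage of `y` and cancelling.
  have e := congrArg ((nfIso S τ₁).inv.app m) (TreeHom.congr_app ef ((nfIso S τ₁').inv.app m y))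
  simp only [TreeHom.comp, TreeIso.hom_inv_app, TreeIso.inv_hom_app] at e
  rw [e]

/-- Delays and the functorial action of warps are handled together: `f` the identity gives the
former, `p = q` the latter. -/
theorem delay_warp {p q : TimeWarp} (h : q ≤ p) {τ τ' : Ty G} {f : TreeHom (τ.sem S) (τ'.sem S)}
    (hf : Coh S τ τ' f) :
    Coh S (.warp p τ) (.warp q τ') ((TreeHom.delay h _).comp (TreeHom.warpMap q f)) := by
  obtain ⟨g, hg, e⟩ := hf
  obtain ⟨g', hg', e'⟩ := hg.push h
  refine ⟨g', hg', TreeHom.ext_app fun n x => ?_⟩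
  refine Eq.trans ?_ (TreeHom.congr_app e' ((TreeHom.warpMap p (nfIso S τ).hom).app n x))
  refine congrArg ((pushIso S q τ'.normal).hom.app n) (Subtype.ext <| funext fun m =>
    funext fun hm => TreeHom.congr_app e _)

theorem warp (p : TimeWarp) {τ τ' : Ty G} {f : TreeHom (τ.sem S) (τ'.sem S)}
    (hf : Coh S τ τ' f) : Coh S (.warp p τ) (.warp p τ') (TreeHom.warpMap p f) :=
  delay_warp le_rfl hf

theorem delay {p q : TimeWarp} (h : q ≤ p) (τ : Ty G) :
    Coh S (.warp p τ) (.warp q τ) (TreeHom.delay h _) :=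
  delay_warp h (refl S τ)

theorem concat (p q : TimeWarp) (τ : Ty G) :
    Coh S (.warp p (.warp q τ)) (.warp (p.mul q) τ) (TreeHom.concat p q _) := by
  obtain ⟨g, hg, e⟩ := Prec.push_push (S := S) p q τ.normal
  refine ⟨g, hg, TreeHom.ext_app fun n x => ?_⟩
  exact TreeHom.congr_app e
    ((TreeHom.warpMap p (TreeHom.warpMap q (nfIso S τ).hom)).app n x)

theorem inflate (ν : G) :
    Coh S (.ground ν) (.warp TimeWarp.omega (.ground ν)) (TreeHom.inflate (S ν)) :=
  ⟨_, .warp TimeWarp.omega_mul_omega.le (.ground ν), rfl⟩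

theorem dist (p : TimeWarp) (τ₁ τ₂ : Ty G) :
    Coh S (.warp p (.prod τ₁ τ₂)) (.prod (.warp p τ₁) (.warp p τ₂)) (TreeHom.dist p _ _) :=
  ⟨_, Prec.refl S _, rfl⟩

end Coh

/-! ### Normal types -/

/-- Normal types. -/
inductive Ty.IsNormal : Ty G → Prop
  | ground {p : TimeWarp} (hp : p.mul TimeWarp.omega = p) (ν : G) : IsNormal (.warp p (.ground ν))
  | stream (p : TimeWarp) {τ : Ty G} : IsNormal τ → IsNormal (.warp p (.stream τ))
  | arrow (p : TimeWarp) {τ₁ τ₂ : Ty G} :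
      IsNormal τ₁ → IsNormal τ₂ → IsNormal (.warp p (.arrow τ₁ τ₂))
  | sum (p : TimeWarp) {τ₁ τ₂ : Ty G} :
      IsNormal τ₁ → IsNormal τ₂ → IsNormal (.warp p (.sum τ₁ τ₂))
  | prod {τ₁ τ₂ : Ty G} : IsNormal τ₁ → IsNormal τ₂ → IsNormal (.prod τ₁ τ₂)

namespace Ty

theorem IsNormal.push (p : TimeWarp) {τ : Ty G} (h : τ.IsNormal) : (τ.push p).IsNormal := by
  induction h with
  | @ground q hq ν => exact .ground (by rw [TimeWarp.mul_assoc, hq]) ν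
  | stream q h => exact .stream _ h
  | arrow q h h' => exact .arrow _ h h'
  | sum q h h' => exact .sum _ h h'
  | prod _ _ ih ih' => exact .prod ih ih'

theorem isNormal_normal (τ : Ty G) : τ.normal.IsNormal := by
  induction τ with
  | ground ν => exact .ground TimeWarp.omega_mul_omega ν
  | stream τ ih => exact .stream _ ih
  | arrow τ₁ τ₂ ih₁ ih₂ => exact .arrow _ ih₁ ih₂
  | prod τ₁ τ₂ ih₁ ih₂ => exact .prod ih₁ ih₂
  | sum τ₁ τ₂ ih₁ ih₂ => exact .sum _ ih₁ ih₂
  | warp p τ ih => exact ih.push p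

/-- Normalizing a warped ground type multiplies its warp by `omega`; the side condition in
`IsNormal.ground` says exactly that this changes nothing. -/
theorem IsNormal.normal_eq {τ : Ty G} (h : τ.IsNormal) : τ.normal = τ := by
  induction h with
  | @ground q hq ν =>
    show Ty.warp (q.mul TimeWarp.omega) _ = _
    rw [hq]
  | @stream q τ h ih =>
    show Ty.warp q (.stream τ.normal) = _
    rw [ih]
  | @arrow q τ₁ τ₂ h h' ih ih' =>
    show Ty.warp q (.arrow τ₁.normal τ₂.normal) = _
    rw [ih, ih']
  | @sum q τ₁ τ₂ h h' ih ih' =>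
    show Ty.warp q (.sum τ₁.normal τ₂.normal) = _
    rw [ih, ih']
  | @prod τ₁ τ₂ _ _ ih ih' =>
    show Ty.prod τ₁.normal τ₂.normal = _
    rw [ih, ih']

theorem IsNormal.push_one {τ : Ty G} (h : τ.IsNormal) : τ.push TimeWarp.one = τ := by
  induction h with
  | @prod τ₁ τ₂ _ _ ih ih' =>
    show Ty.prod (τ₁.push _) (τ₂.push _) = _
    rw [ih, ih']
  | _ => rfl

theorem push_push (p q : TimeWarp) (τ : Ty G) : (τ.push q).push p = τ.push (p.mul q) := by
  induction τ with
  | prod τ₁ τ₂ ih₁ ih₂ =>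
    show Ty.prod ((τ₁.push _).push _) ((τ₂.push _).push _) = Ty.prod (τ₁.push _) (τ₂.push _)
    rw [ih₁, ih₂]
  | _ => rfl

end Ty

/-- Normality is essential, since without an outer warp there is no precedence from `τ` to its
warping. With one, restriction only weakens the bound on the indices, so the concatenation reads off
the original component at whichever intermediate step it chooses, and the composite is the identity
by definition. -/
theorem Prec.wrap {τ : Ty G} (h : τ.IsNormal) :
    ∃ g, Prec S τ (τ.push TimeWarp.one) g ∧
      (TreeHom.wrap (τ.sem S)).comp (pushIso S TimeWarp.one τ).hom = g := by
  have key : ∀ (q : TimeWarp) (σ : Ty G),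
      (TreeHom.wrap ((Ty.warp q σ).sem S)).comp (pushIso S TimeWarp.one (.warp q σ)).hom =
        TreeHom.id _ := fun q σ =>
    rfl
  induction h with
  | prod _ _ ih₁ ih₂ =>
    obtain ⟨g₁, hg₁, e₁⟩ := ih₁
    obtain ⟨g₂, hg₂, e₂⟩ := ih₂
    exact ⟨_, .prod hg₁ hg₂, TreeHom.ext_app fun n x =>
      Prod.ext (TreeHom.congr_app e₁ x.1) (TreeHom.congr_app e₂ x.2)⟩
  | _ => exact ⟨_, Prec.refl S _, key _ _⟩

theorem Coh.wrap (τ : Ty G) : Coh S τ (.warp TimeWarp.one τ) (TreeHom.wrap _) := by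
  obtain ⟨g, hg, e⟩ := Prec.wrap (S := S) τ.isNormal_normal
  refine ⟨g, hg, TreeHom.ext_app fun n x => ?_⟩
  refine Eq.trans ?_ (TreeHom.congr_app e _)
  refine congrArg ((pushIso S TimeWarp.one τ.normal).hom.app n) (Subtype.ext <| funext fun m =>
    funext fun hm => (nfIso S τ).hom.nat _ _)

/-- Coherence: the interpretation of a coercion depends only on its source and target. -/
theorem Sub.coh (S : G → Type v) {α : Coercion} {τ τ' : Ty G} (a : Sub α τ τ') :
    Coh S τ τ' (a.sem S) := by
  induction a with
  | id τ => exact .refl S τ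
  | comp _ _ ih₁ ih₂ => exact ih₁.trans ih₂
  | stream _ ih => exact ih.stream
  | arrow _ _ ih₁ ih₂ => exact ih₁.arrow ih₂
  | prod _ _ ih₁ ih₂ => exact ih₁.prod ih₂
  | sum _ _ ih₁ ih₂ => exact ih₁.sum ih₂
  | warp p _ ih => exact ih.warp p
  | wrap τ => exact .wrap τ
  | unwrap τ =>
    exact Coh.symm (τ' := .warp TimeWarp.one τ) (i := TreeIso.wrap (τ.sem S)) (.wrap τ)
      τ.isNormal_normal.push_one
  | concat p q τ => exact .concat p q τ
  | decat p q τ =>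
    exact Coh.symm (τ := .warp p (.warp q τ)) (τ' := .warp (p.mul q) τ)
      (i := TreeIso.concat p q (τ.sem S)) (.concat p q τ) (Ty.push_push p q τ.normal).symm
  | inflate ν => exact .inflate ν
  | dist p τ₁ τ₂ => exact .dist p τ₁ τ₂
  | fact p τ₁ τ₂ =>
    exact Coh.symm (τ := .warp p (.prod τ₁ τ₂)) (τ' := .prod (.warp p τ₁) (.warp p τ₂))
      (i := TreeIso.dist p (τ₁.sem S) (τ₂.sem S)) (.dist p τ₁ τ₂) rfl
  | delay h τ => exact .delay h τ

/-! ### Algorithmic subtyping -/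

theorem pushIn_hasSub (p : TimeWarp) (τ : Ty G) : HasSub (pushIn p τ) (.warp p τ) (τ.push p) := by
  induction τ with
  | prod τ₁ τ₂ ih₁ ih₂ =>
    obtain ⟨a₁⟩ := ih₁
    obtain ⟨a₂⟩ := ih₂
    exact ⟨.comp (.dist p τ₁ τ₂) (.prod a₁ a₂)⟩
  | warp q τ => exact ⟨.concat p q τ⟩
  | _ => exact ⟨.id _⟩

theorem pushOut_hasSub (p : TimeWarp) (τ : Ty G) : HasSub (pushOut p τ) (τ.push p) (.warp p τ) := by
  induction τ with
  | prod τ₁ τ₂ ih₁ ih₂ =>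
    obtain ⟨a₁⟩ := ih₁
    obtain ⟨a₂⟩ := ih₂
    exact ⟨.comp (.prod a₁ a₂) (.fact p τ₁ τ₂)⟩
  | warp q τ => exact ⟨.decat p q τ⟩
  | _ => exact ⟨.id _⟩

theorem norm_warp_hasSub {p : TimeWarp} {τ : Ty G} {α α' : Coercion}
    (h : HasSub α τ τ.normal ∧ HasSub α' τ.normal τ) :
    HasSub (.comp (.warp p α) (pushIn p τ.normal)) (.warp p τ) (τ.normal.push p) ∧
      HasSub (.comp (pushOut p τ.normal) (.warp p α')) (τ.normal.push p) (.warp p τ) := by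
  obtain ⟨⟨a⟩, ⟨a'⟩⟩ := h
  obtain ⟨b⟩ := pushIn_hasSub p τ.normal
  obtain ⟨b'⟩ := pushOut_hasSub p τ.normal
  exact ⟨⟨.comp (.warp p a) b⟩, ⟨.comp b' (.warp p a')⟩⟩

/-- Both directions are proved together because arrows exchange them. The recursion is on size: a
warped product recurses on two warped factors, which are not subterms. -/
theorem norm_hasSub : ∀ τ : Ty G,
    HasSub (normIn τ) τ τ.normal ∧ HasSub (normOut τ) τ.normal τ
  | .ground ν => by
    rw [normIn, normOut]
    exact ⟨⟨.inflate ν⟩, ⟨.comp (.delay (TimeWarp.le_omega _) _) (.unwrap _)⟩⟩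
  | .stream τ => by
    rw [normIn, normOut]
    obtain ⟨⟨a⟩, ⟨b⟩⟩ := norm_hasSub τ
    exact ⟨⟨.comp (.stream a) (.wrap _)⟩, ⟨.comp (.unwrap _) (.stream b)⟩⟩
  | .arrow τ₁ τ₂ => by
    rw [normIn, normOut]
    obtain ⟨⟨a⟩, ⟨b⟩⟩ := norm_hasSub τ₁
    obtain ⟨⟨a'⟩, ⟨b'⟩⟩ := norm_hasSub τ₂
    exact ⟨⟨.comp (.arrow b a') (.wrap _)⟩, ⟨.comp (.unwrap _) (.arrow a b')⟩⟩
  | .prod τ₁ τ₂ => by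
    rw [normIn, normOut]
    obtain ⟨⟨a⟩, ⟨b⟩⟩ := norm_hasSub τ₁
    obtain ⟨⟨a'⟩, ⟨b'⟩⟩ := norm_hasSub τ₂
    exact ⟨⟨.prod a a'⟩, ⟨.prod b b'⟩⟩
  | .sum τ₁ τ₂ => by
    rw [normIn, normOut]
    obtain ⟨⟨a⟩, ⟨b⟩⟩ := norm_hasSub τ₁
    obtain ⟨⟨a'⟩, ⟨b'⟩⟩ := norm_hasSub τ₂
    exact ⟨⟨.comp (.sum a a') (.wrap _)⟩, ⟨.comp (.unwrap _) (.sum b b')⟩⟩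
  | .warp p (.prod τ₁ τ₂) => by
    rw [normIn, normOut]
    obtain ⟨⟨a⟩, ⟨b⟩⟩ := norm_hasSub (.warp p τ₁)
    obtain ⟨⟨a'⟩, ⟨b'⟩⟩ := norm_hasSub (.warp p τ₂)
    exact ⟨⟨.comp (.dist _ _ _) (.prod a a')⟩, ⟨.comp (.prod b b') (.fact _ _ _)⟩⟩
  | .warp p (.ground ν) => by
    rw [normIn, normOut]
    · exact norm_warp_hasSub (norm_hasSub (.ground ν))
    -- The generic clause for warps applies only when the body is not a product; the remaining goals
    -- state this.
    all_goals simp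
  | .warp p (.stream τ) => by
    rw [normIn, normOut]
    · exact norm_warp_hasSub (norm_hasSub (.stream τ))
    all_goals simp
  | .warp p (.arrow τ₁ τ₂) => by
    rw [normIn, normOut]
    · exact norm_warp_hasSub (norm_hasSub (.arrow τ₁ τ₂))
    all_goals simp
  | .warp p (.sum τ₁ τ₂) => by
    rw [normIn, normOut]
    · exact norm_warp_hasSub (norm_hasSub (.sum τ₁ τ₂))
    all_goals simp
  | .warp p (.warp q τ) => by
    rw [normIn, normOut]
    · exact norm_warp_hasSub (norm_hasSub (.warp q τ))
    all_goals simp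
termination_by τ => sizeOf τ

theorem Prec.prec_eq {τ τ' : Ty G} {f : TreeHom (τ.sem S) (τ'.sem S)} (h : Prec S τ τ' f) :
    ∃ α, prec τ τ' = some α ∧ HasSub α τ τ' := by
  induction h with
  | ground ν => exact ⟨.id, by simp [prec], ⟨.id _⟩⟩
  | stream _ ih =>
    obtain ⟨α, h, ⟨a⟩⟩ := ih
    exact ⟨_, by simp [prec, h], ⟨.stream a⟩⟩
  | arrow _ _ ih₁ ih₂ =>
    obtain ⟨α, h, ⟨a⟩⟩ := ih₁
    obtain ⟨α', h', ⟨a'⟩⟩ := ih₂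
    exact ⟨_, by simp [prec, h, h'], ⟨.arrow a a'⟩⟩
  | prod _ _ ih₁ ih₂ =>
    obtain ⟨α, h, ⟨a⟩⟩ := ih₁
    obtain ⟨α', h', ⟨a'⟩⟩ := ih₂
    exact ⟨_, by simp [prec, h, h'], ⟨.prod a a'⟩⟩
  | sum _ _ ih₁ ih₂ =>
    obtain ⟨α, h, ⟨a⟩⟩ := ih₁
    obtain ⟨α', h', ⟨a'⟩⟩ := ih₂
    exact ⟨_, by simp [prec, h, h'], ⟨.sum a a'⟩⟩
  | warp hpq _ ih =>
    obtain ⟨α, h, ⟨a⟩⟩ := ih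
    exact ⟨_, by simp [prec, h, hpq], ⟨.comp (.delay hpq _) (.warp _ a)⟩⟩

/-- Completeness of algorithmic subtyping. -/
theorem Coh.coerce_eq {τ τ' : Ty G} {f : TreeHom (τ.sem S) (τ'.sem S)} (h : Coh S τ τ' f) :
    ∃ α, coerce τ τ' = some α ∧ ∃ a : Sub α τ τ', a.sem S = f := by
  have h' := h
  obtain ⟨g, hg, -⟩ := h'
  obtain ⟨α, e, ⟨a⟩⟩ := hg.prec_eq
  obtain ⟨b⟩ := (norm_hasSub τ).1
  obtain ⟨c⟩ := (norm_hasSub τ').2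
  -- The interpretation of the composite is never computed: it is coherent like that of any
  -- coercion, hence equal to `f`.
  exact ⟨_, by simp [coerce, e], .comp (.comp b a) c, (Sub.coh S _).unique h⟩

/-! ### Division and suprema of normal types -/

/-- Existence of a precedence morphism. -/
def Le (S : G → Type v) (τ τ' : Ty G) : Prop := ∃ f, Prec S τ τ' f

theorem Le.refl (S : G → Type v) (τ : Ty G) : Le S τ τ := ⟨_, Prec.refl S τ⟩

theorem Le.coh {τ τ' : Ty G} (h : Le S τ.normal τ'.normal) : ∃ f, Coh S τ τ' f :=
  Coh.exists_of_prec h.choose_spec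

theorem Coh.le {τ τ' : Ty G} {f : TreeHom (τ.sem S) (τ'.sem S)} (h : Coh S τ τ' f) :
    Le S τ.normal τ'.normal := ⟨_, h.choose_spec.1⟩

theorem Ty.IsNormal.divNormal (p : TimeWarp) {τ : Ty G} (h : τ.IsNormal) :
    (τ.divNormal p).IsNormal := by
  induction h with
  | ground hq ν => exact .ground (TimeWarp.div_mul_omega hq) ν
  | stream q h => exact .stream _ h
  | arrow q h h' => exact .arrow _ h h'
  | sum q h h' => exact .sum _ h h'
  | prod _ _ ih ih' => exact .prod ih ih'

/-- The inequality `p.mul (q.div p) ≤ q`, applied to each outermost warp. Larger warps give smaller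
types. -/
theorem Ty.IsNormal.le_push_divNormal (S : G → Type v) (p : TimeWarp) {τ : Ty G}
    (h : τ.IsNormal) : Le S τ ((τ.divNormal p).push p) := by
  induction h with
  | prod _ _ ih ih' =>
    obtain ⟨_, h⟩ := ih
    obtain ⟨_, h'⟩ := ih'
    exact ⟨_, .prod h h'⟩
  | _ => exact ⟨_, .warp (TimeWarp.le_div_iff.1 le_rfl) (Prec.refl S _)⟩

/-- The universal property of division: the divided type is the least normal type whose warping by
`p` lies above `τ`. -/
theorem Le.divNormal_le {p : TimeWarp} {τ τ' : Ty G} (h' : τ'.IsNormal)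
    (h : Le S τ (τ'.push p)) : Le S (τ.divNormal p) τ' := by
  obtain ⟨f, h⟩ := h
  induction h' generalizing τ with
  | prod _ _ ih ih' =>
    cases h with | prod h h' =>
    obtain ⟨_, h⟩ := ih _ h
    obtain ⟨_, h'⟩ := ih' _ h'
    exact ⟨_, .prod h h'⟩
  | _ => cases h with | warp h h' => exact ⟨_, .warp (TimeWarp.le_div_iff.2 h) h'⟩

/-- The induction is on the common bound `σ`, which forces the two types to have the same shape, so
that the traversal in lockstep cannot fail. Suprema and infima are treated together because arrows
exchange them. As `κ` is computed without reference to `σ`, it lies below every upper bound,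
respectively above every lower bound. -/
theorem exists_supNormal_infNormal (S : G → Type v) (σ : Ty G) :
    (∀ {τ τ' : Ty G}, Le S τ σ → Le S τ' σ →
      ∃ κ, supNormal τ τ' = some κ ∧ Le S τ κ ∧ Le S τ' κ ∧ Le S κ σ) ∧
    (∀ {τ τ' : Ty G}, Le S σ τ → Le S σ τ' →
      ∃ κ, infNormal τ τ' = some κ ∧ Le S κ τ ∧ Le S κ τ' ∧ Le S σ κ) := by
  induction σ with
  | ground ν =>
    constructor <;>
    · rintro τ τ' ⟨_, h⟩ ⟨_, h'⟩
      cases h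
      cases h'
      exact ⟨_, by simp [supNormal, infNormal], ⟨_, .ground ν⟩, ⟨_, .ground ν⟩, ⟨_, .ground ν⟩⟩
  | stream σ ih =>
    constructor
    · rintro τ τ' ⟨_, h⟩ ⟨_, h'⟩
      cases h with | stream h => cases h' with | stream h' =>
      obtain ⟨κ, e, ⟨_, a⟩, ⟨_, b⟩, ⟨_, c⟩⟩ := ih.1 ⟨_, h⟩ ⟨_, h'⟩
      exact ⟨_, by simp [supNormal, e], ⟨_, .stream a⟩, ⟨_, .stream b⟩, ⟨_, .stream c⟩⟩
    · rintro τ τ' ⟨_, h⟩ ⟨_, h'⟩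
      cases h with | stream h => cases h' with | stream h' =>
      obtain ⟨κ, e, ⟨_, a⟩, ⟨_, b⟩, ⟨_, c⟩⟩ := ih.2 ⟨_, h⟩ ⟨_, h'⟩
      exact ⟨_, by simp [infNormal, e], ⟨_, .stream a⟩, ⟨_, .stream b⟩, ⟨_, .stream c⟩⟩
  | arrow σ₁ σ₂ ih₁ ih₂ =>
    constructor
    · rintro τ τ' ⟨_, h⟩ ⟨_, h'⟩
      cases h with | arrow h₁ h₂ => cases h' with | arrow h₁' h₂' =>
      obtain ⟨κ₁, e₁, ⟨_, a₁⟩, ⟨_, b₁⟩, ⟨_, c₁⟩⟩ := ih₁.2 ⟨_, h₁⟩ ⟨_, h₁'⟩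
      obtain ⟨κ₂, e₂, ⟨_, a₂⟩, ⟨_, b₂⟩, ⟨_, c₂⟩⟩ := ih₂.1 ⟨_, h₂⟩ ⟨_, h₂'⟩
      exact ⟨_, by simp [supNormal, e₁, e₂],
        ⟨_, .arrow a₁ a₂⟩, ⟨_, .arrow b₁ b₂⟩, ⟨_, .arrow c₁ c₂⟩⟩
    · rintro τ τ' ⟨_, h⟩ ⟨_, h'⟩
      cases h with | arrow h₁ h₂ => cases h' with | arrow h₁' h₂' =>
      obtain ⟨κ₁, e₁, ⟨_, a₁⟩, ⟨_, b₁⟩, ⟨_, c₁⟩⟩ := ih₁.1 ⟨_, h₁⟩ ⟨_, h₁'⟩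
      obtain ⟨κ₂, e₂, ⟨_, a₂⟩, ⟨_, b₂⟩, ⟨_, c₂⟩⟩ := ih₂.2 ⟨_, h₂⟩ ⟨_, h₂'⟩
      exact ⟨_, by simp [infNormal, e₁, e₂],
        ⟨_, .arrow a₁ a₂⟩, ⟨_, .arrow b₁ b₂⟩, ⟨_, .arrow c₁ c₂⟩⟩
  | prod σ₁ σ₂ ih₁ ih₂ =>
    constructor
    · rintro τ τ' ⟨_, h⟩ ⟨_, h'⟩
      cases h with | prod h₁ h₂ => cases h' with | prod h₁' h₂' =>
      obtain ⟨κ₁, e₁, ⟨_, a₁⟩, ⟨_, b₁⟩, ⟨_, c₁⟩⟩ := ih₁.1 ⟨_, h₁⟩ ⟨_, h₁'⟩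
      obtain ⟨κ₂, e₂, ⟨_, a₂⟩, ⟨_, b₂⟩, ⟨_, c₂⟩⟩ := ih₂.1 ⟨_, h₂⟩ ⟨_, h₂'⟩
      exact ⟨_, by simp [supNormal, e₁, e₂],
        ⟨_, .prod a₁ a₂⟩, ⟨_, .prod b₁ b₂⟩, ⟨_, .prod c₁ c₂⟩⟩
    · rintro τ τ' ⟨_, h⟩ ⟨_, h'⟩
      cases h with | prod h₁ h₂ => cases h' with | prod h₁' h₂' =>
      obtain ⟨κ₁, e₁, ⟨_, a₁⟩, ⟨_, b₁⟩, ⟨_, c₁⟩⟩ := ih₁.2 ⟨_, h₁⟩ ⟨_, h₁'⟩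
      obtain ⟨κ₂, e₂, ⟨_, a₂⟩, ⟨_, b₂⟩, ⟨_, c₂⟩⟩ := ih₂.2 ⟨_, h₂⟩ ⟨_, h₂'⟩
      exact ⟨_, by simp [infNormal, e₁, e₂],
        ⟨_, .prod a₁ a₂⟩, ⟨_, .prod b₁ b₂⟩, ⟨_, .prod c₁ c₂⟩⟩
  | sum σ₁ σ₂ ih₁ ih₂ =>
    constructor
    · rintro τ τ' ⟨_, h⟩ ⟨_, h'⟩
      cases h with | sum h₁ h₂ => cases h' with | sum h₁' h₂' =>
      obtain ⟨κ₁, e₁, ⟨_, a₁⟩, ⟨_, b₁⟩, ⟨_, c₁⟩⟩ := ih₁.1 ⟨_, h₁⟩ ⟨_, h₁'⟩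
      obtain ⟨κ₂, e₂, ⟨_, a₂⟩, ⟨_, b₂⟩, ⟨_, c₂⟩⟩ := ih₂.1 ⟨_, h₂⟩ ⟨_, h₂'⟩
      exact ⟨_, by simp [supNormal, e₁, e₂],
        ⟨_, .sum a₁ a₂⟩, ⟨_, .sum b₁ b₂⟩, ⟨_, .sum c₁ c₂⟩⟩
    · rintro τ τ' ⟨_, h⟩ ⟨_, h'⟩
      cases h with | sum h₁ h₂ => cases h' with | sum h₁' h₂' =>
      obtain ⟨κ₁, e₁, ⟨_, a₁⟩, ⟨_, b₁⟩, ⟨_, c₁⟩⟩ := ih₁.2 ⟨_, h₁⟩ ⟨_, h₁'⟩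
      obtain ⟨κ₂, e₂, ⟨_, a₂⟩, ⟨_, b₂⟩, ⟨_, c₂⟩⟩ := ih₂.2 ⟨_, h₂⟩ ⟨_, h₂'⟩
      exact ⟨_, by simp [infNormal, e₁, e₂],
        ⟨_, .sum a₁ a₂⟩, ⟨_, .sum b₁ b₂⟩, ⟨_, .sum c₁ c₂⟩⟩
  | warp r σ ih =>
    constructor
    · rintro τ τ' ⟨_, h⟩ ⟨_, h'⟩
      cases h with | @warp p _ τ _ _ hp h => cases h' with | @warp q _ τ' _ _ hq h' =>
      obtain ⟨κ, e, ⟨_, a⟩, ⟨_, b⟩, ⟨_, c⟩⟩ := ih.1 ⟨_, h⟩ ⟨_, h'⟩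
      exact ⟨_, by simp [supNormal, e], ⟨_, .warp (TimeWarp.inf_le_left _ _) a⟩,
        ⟨_, .warp (TimeWarp.inf_le_right _ _) b⟩, ⟨_, .warp (TimeWarp.le_inf hp hq) c⟩⟩
    · rintro τ τ' ⟨_, h⟩ ⟨_, h'⟩
      cases h with | warp hp h => cases h' with | warp hq h' =>
      obtain ⟨κ, e, ⟨_, a⟩, ⟨_, b⟩, ⟨_, c⟩⟩ := ih.2 ⟨_, h⟩ ⟨_, h'⟩
      exact ⟨_, by simp [infNormal, e], ⟨_, .warp (TimeWarp.le_sup_left _ _) a⟩,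
        ⟨_, .warp (TimeWarp.le_sup_right _ _) b⟩, ⟨_, .warp (TimeWarp.sup_le hp hq) c⟩⟩

theorem Ty.IsNormal.supNormal_infNormal {τ τ' κ : Ty G} (h : τ.IsNormal) (h' : τ'.IsNormal) :
    (supNormal τ τ' = some κ → κ.IsNormal) ∧ (infNormal τ τ' = some κ → κ.IsNormal) := by
  induction h generalizing τ' κ with
  | ground hp ν =>
    cases h' with
    | ground hq ν' =>
      by_cases h : ν = ν'
      · simp only [supNormal, infNormal, h, if_true]
        constructor <;> rintro ⟨⟩
        · exact .ground (TimeWarp.inf_mul_omega hp hq) _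
        · exact .ground (TimeWarp.sup_mul_omega hp hq) _
      · simp [supNormal, infNormal, h]
    | _ => simp [supNormal, infNormal]
  | stream p _ ih =>
    cases h' with
    | stream q h' =>
      simp only [supNormal, infNormal, Option.bind_eq_bind, Option.bind_eq_some_iff, Option.pure_def]
      constructor <;> rintro ⟨_, ⟨κ, e, ⟨⟩⟩, ⟨⟩⟩
      · exact .stream _ ((ih h').1 e)
      · exact .stream _ ((ih h').2 e)
    | _ => simp [supNormal, infNormal]
  | arrow p _ _ ih₁ ih₂ =>
    cases h' with
    | arrow q h₁ h₂ =>
      simp only [supNormal, infNormal, Option.bind_eq_bind, Option.bind_eq_some_iff, Option.pure_def]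
      constructor <;> rintro ⟨_, ⟨κ, e, κ', e', ⟨⟩⟩, ⟨⟩⟩
      · exact .arrow _ ((ih₁ h₁).2 e) ((ih₂ h₂).1 e')
      · exact .arrow _ ((ih₁ h₁).1 e) ((ih₂ h₂).2 e')
    | _ => simp [supNormal, infNormal]
  | sum p _ _ ih₁ ih₂ =>
    cases h' with
    | sum q h₁ h₂ =>
      simp only [supNormal, infNormal, Option.bind_eq_bind, Option.bind_eq_some_iff, Option.pure_def]
      constructor <;> rintro ⟨_, ⟨κ, e, κ', e', ⟨⟩⟩, ⟨⟩⟩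
      · exact .sum _ ((ih₁ h₁).1 e) ((ih₂ h₂).1 e')
      · exact .sum _ ((ih₁ h₁).2 e) ((ih₂ h₂).2 e')
    | _ => simp [supNormal, infNormal]
  | prod _ _ ih₁ ih₂ =>
    cases h' with
    | prod h₁ h₂ =>
      simp only [supNormal, infNormal, Option.bind_eq_bind, Option.bind_eq_some_iff, Option.pure_def]
      constructor <;> rintro ⟨κ, e, κ', e', ⟨⟩⟩
      · exact .prod ((ih₁ h₁).1 e) ((ih₂ h₂).1 e')
      · exact .prod ((ih₁ h₁).2 e) ((ih₂ h₂).2 e')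
    | _ => simp [supNormal, infNormal]

/-- The supremum is normal, hence its own normal form, so the inequalities between normal types
yield coherent morphisms. The factorizations follow from uniqueness. -/
theorem Coh.exists_sup {τ₁ τ₂ σ : Ty G} {f₁ : TreeHom (τ₁.sem S) (σ.sem S)}
    {f₂ : TreeHom (τ₂.sem S) (σ.sem S)} (h₁ : Coh S τ₁ σ f₁) (h₂ : Coh S τ₂ σ f₂) :
    ∃ κ c₁ c₂ c, τ₁.sup? τ₂ = some κ ∧ Coh S τ₁ κ c₁ ∧ Coh S τ₂ κ c₂ ∧ Coh S κ σ c ∧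
      f₁ = c₁.comp c ∧ f₂ = c₂.comp c := by
  obtain ⟨κ, e, l₁, l₂, l⟩ := (exists_supNormal_infNormal S σ.normal).1 h₁.le h₂.le
  have hκ := (τ₁.isNormal_normal.supNormal_infNormal τ₂.isNormal_normal).1 e
  rw [← hκ.normal_eq] at l₁ l₂ l
  obtain ⟨c₁, hc₁⟩ := l₁.coh
  obtain ⟨c₂, hc₂⟩ := l₂.coh
  obtain ⟨c, hc⟩ := l.coh
  exact ⟨κ, c₁, c₂, c, e, hc₁, hc₂, hc, h₁.unique (hc₁.trans hc), h₂.unique (hc₂.trans hc)⟩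

/-! ### Inversion of subtyping -/

/-- Precedence preserves the head constructor, so the target dictates the shape of the normal form
of `τ`. The factorization separates the coercion inserted by elaboration from a componentwise one,
which commutes with the projections. -/
theorem Coh.prod_inv {τ τ₁ τ₂ : Ty G} {f : TreeHom (τ.sem S) ((Ty.prod τ₁ τ₂).sem S)}
    (h : Coh S τ (.prod τ₁ τ₂) f) :
    ∃ σ₁ σ₂, τ.normal = .prod σ₁ σ₂ ∧ ∃ c c₁ c₂, Coh S τ (.prod σ₁ σ₂) c ∧ Coh S σ₁ τ₁ c₁ ∧
      Coh S σ₂ τ₂ c₂ ∧ f = c.comp (TreeHom.prodMap c₁ c₂) := by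
  obtain ⟨g, hg⟩ := h.le
  have hn := τ.isNormal_normal
  generalize e : τ.normal = σ at g hg hn
  cases hg with | @prod σ₁ _ σ₂ _ _ _ a b =>
  cases hn with | prod n₁ n₂ =>
  obtain ⟨c₁, h₁⟩ := Le.coh (S := S) (τ := σ₁) (τ' := τ₁) (by rw [n₁.normal_eq]; exact ⟨_, a⟩)
  obtain ⟨c₂, h₂⟩ := Le.coh (S := S) (τ := σ₂) (τ' := τ₂) (by rw [n₂.normal_eq]; exact ⟨_, b⟩)
  obtain ⟨c, hc⟩ := Le.coh (S := S) (τ := τ) (τ' := .prod σ₁ σ₂)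
    (by rw [e, (n₁.prod n₂).normal_eq]; exact Le.refl S _)
  exact ⟨σ₁, σ₂, rfl, c, c₁, c₂, hc, h₁, h₂, h.unique (hc.trans (h₁.prod h₂))⟩

/-- As for products, except that the normal form carries an outer warp `q`. The target has the
identity as its outer warp, so `q` is at least the identity and can be delayed away. -/
theorem Coh.sum_inv {τ τ₁ τ₂ : Ty G} {f : TreeHom (τ.sem S) ((Ty.sum τ₁ τ₂).sem S)}
    (h : Coh S τ (.sum τ₁ τ₂) f) :
    ∃ q σ₁ σ₂, τ.normal = .warp q (.sum σ₁ σ₂) ∧ ∃ c c₁ c₂, Coh S τ (.sum σ₁ σ₂) c ∧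
      Coh S σ₁ τ₁ c₁ ∧ Coh S σ₂ τ₂ c₂ ∧ f = c.comp (TreeHom.sumMap c₁ c₂) := by
  obtain ⟨g, hg⟩ := h.le
  have hn := τ.isNormal_normal
  generalize e : τ.normal = σ at g hg hn
  cases hg with | @warp q _ _ _ _ hq hg => cases hg with | @sum σ₁ _ σ₂ _ _ _ a b =>
  cases hn with | sum _ n₁ n₂ =>
  obtain ⟨c₁, h₁⟩ := Le.coh (S := S) (τ := σ₁) (τ' := τ₁) (by rw [n₁.normal_eq]; exact ⟨_, a⟩)
  obtain ⟨c₂, h₂⟩ := Le.coh (S := S) (τ := σ₂) (τ' := τ₂) (by rw [n₂.normal_eq]; exact ⟨_, b⟩)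
  obtain ⟨c, hc⟩ := Le.coh (S := S) (τ := τ) (τ' := .sum σ₁ σ₂) (by
    rw [e, Ty.normal, n₁.normal_eq, n₂.normal_eq]
    exact ⟨_, .warp hq (Prec.refl S _)⟩)
  exact ⟨q, σ₁, σ₂, rfl, c, c₁, c₂, hc, h₁, h₂, h.unique (hc.trans (h₁.sum h₂))⟩

theorem Coh.arrow_inv {τ τ₁ τ₂ : Ty G} {f : TreeHom (τ.sem S) ((Ty.arrow τ₁ τ₂).sem S)}
    (h : Coh S τ (.arrow τ₁ τ₂) f) :
    ∃ q σ₁ σ₂, τ.normal = .warp q (.arrow σ₁ σ₂) ∧ ∃ c c₁ c₂, Coh S τ (.arrow σ₁ σ₂) c ∧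
      Coh S τ₁ σ₁ c₁ ∧ Coh S σ₂ τ₂ c₂ ∧ f = c.comp (TreeHom.expMap c₁ c₂) := by
  obtain ⟨g, hg⟩ := h.le
  have hn := τ.isNormal_normal
  generalize e : τ.normal = σ at g hg hn
  cases hg with | @warp q _ _ _ _ hq hg => cases hg with | @arrow σ₁ _ σ₂ _ _ _ a b =>
  cases hn with | arrow _ n₁ n₂ =>
  obtain ⟨c₁, h₁⟩ := Le.coh (S := S) (τ := τ₁) (τ' := σ₁) (by rw [n₁.normal_eq]; exact ⟨_, a⟩)
  obtain ⟨c₂, h₂⟩ := Le.coh (S := S) (τ := σ₂) (τ' := τ₂) (by rw [n₂.normal_eq]; exact ⟨_, b⟩)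
  obtain ⟨c, hc⟩ := Le.coh (S := S) (τ := τ) (τ' := .arrow σ₁ σ₂) (by
    rw [e, Ty.normal, n₁.normal_eq, n₂.normal_eq]
    exact ⟨_, .warp hq (Prec.refl S _)⟩)
  exact ⟨q, σ₁, σ₂, rfl, c, c₁, c₂, hc, h₁, h₂, h.unique (hc.trans (h₁.arrow h₂))⟩

theorem Coh.stream_inv {τ τ₁ : Ty G} {f : TreeHom (τ.sem S) ((Ty.stream τ₁).sem S)}
    (h : Coh S τ (.stream τ₁) f) :
    ∃ q σ, τ.normal = .warp q (.stream σ) ∧ ∃ c c₁, Coh S τ (.stream σ) c ∧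
      Coh S σ τ₁ c₁ ∧ f = c.comp c₁.streamMap := by
  obtain ⟨g, hg⟩ := h.le
  have hn := τ.isNormal_normal
  generalize e : τ.normal = σ at g hg hn
  cases hg with | @warp q _ _ _ _ hq hg => cases hg with | @stream σ _ _ a =>
  cases hn with | stream _ n =>
  obtain ⟨c₁, h₁⟩ := Le.coh (S := S) (τ := σ) (τ' := τ₁) (by rw [n.normal_eq]; exact ⟨_, a⟩)
  obtain ⟨c, hc⟩ := Le.coh (S := S) (τ := τ) (τ' := .stream σ) (by
    rw [e, Ty.normal, n.normal_eq]
    exact ⟨_, .warp hq (Prec.refl S _)⟩)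
  exact ⟨q, σ, rfl, c, c₁, hc, h₁, h.unique (hc.trans h₁.stream)⟩

/-- The version needed for the second argument of a stream constructor, where the outer warp is
delayed to `p` instead of the identity. -/
theorem Coh.warp_stream_inv {p : TimeWarp} {τ τ₁ : Ty G}
    {f : TreeHom (τ.sem S) ((Ty.warp p (.stream τ₁)).sem S)} (h : Coh S τ (.warp p (.stream τ₁)) f) :
    ∃ q σ, τ.normal = .warp q (.stream σ) ∧ ∃ c c₁, Coh S τ (.warp p (.stream σ)) c ∧
      Coh S σ τ₁ c₁ ∧ f = c.comp (TreeHom.warpMap p c₁.streamMap) := by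
  obtain ⟨g, hg⟩ := h.le
  have hn := τ.isNormal_normal
  generalize e : τ.normal = σ at g hg hn
  cases hg with | @warp q _ _ _ _ hq hg => cases hg with | @stream σ _ _ a =>
  cases hn with | stream _ n =>
  obtain ⟨c₁, h₁⟩ := Le.coh (S := S) (τ := σ) (τ' := τ₁) (by rw [n.normal_eq]; exact ⟨_, a⟩)
  obtain ⟨c, hc⟩ := Le.coh (S := S) (τ := τ) (τ' := .warp p (.stream σ)) (by
    rw [e, Ty.normal, Ty.normal, n.normal_eq]
    exact ⟨_, .warp hq (Prec.refl S _)⟩)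
  exact ⟨q, σ, rfl, c, c₁, hc, h₁, h.unique (hc.trans (h₁.stream.warp p))⟩

theorem Coh.exists_div (S : G → Type v) (p : TimeWarp) (τ : Ty G) :
    ∃ c, Coh S τ (.warp p (τ.normal.divNormal p)) c :=
  Le.coh (by
    rw [Ty.normal, (τ.isNormal_normal.divNormal p).normal_eq]
    exact τ.isNormal_normal.le_push_divNormal S p)

theorem Coh.div_inv {p : TimeWarp} {τ τ' : Ty G} {f : TreeHom (τ.sem S) ((Ty.warp p τ').sem S)}
    (h : Coh S τ (.warp p τ') f) : ∃ c, Coh S (τ.normal.divNormal p) τ' c :=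
  Le.coh (by
    rw [(τ.isNormal_normal.divNormal p).normal_eq]
    exact Le.divNormal_le τ'.isNormal_normal h.le)

/-! ### Renaming and erasure -/

theorem liftVar_id (n : ℕ) : liftVar (fun i : Fin n => i) = fun i => i := by
  funext i
  refine Fin.cases rfl (fun j => rfl) i

theorem liftVar_comp {n m k : ℕ} (σ : Fin n → Fin m) (σ' : Fin m → Fin k) :
    liftVar (fun i => σ' (σ i)) = fun i => liftVar σ' (liftVar σ i) := by
  funext i
  refine Fin.cases rfl (fun j => rfl) i

namespace Tm

theorem rename_id {n : ℕ} (t : Tm G S n) : t.rename (fun i => i) = t := by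
  induction t <;> simp_all [rename, liftVar_id]

theorem rename_rename {n m k : ℕ} (σ : Fin n → Fin m) (σ' : Fin m → Fin k) (t : Tm G S n) :
    (t.rename σ).rename σ' = t.rename fun i => σ' (σ i) := by
  induction t generalizing m k <;> simp_all [rename, liftVar_comp]

/-- In a contravariant coercion a renaming only composes with the recorded map of variables, which
erasure then carries out; the claim there is functoriality of renaming. -/
theorem erase_rename {n m : ℕ} (σ : Fin n → Fin m) (t : Tm G S n) :
    (t.rename σ).erase = t.erase.rename σ := by
  induction t generalizing m <;> simp_all [rename, erase, rename_rename]

end Tm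

/-! ### Elaboration and its interpretation -/

/-- `Elab S Γ t τ f`: the implicit term `t` elaborates in `Γ` to a term of type `τ` that
denotes `f`. -/
inductive Elab (S : G → Type v) :
    {n : ℕ} → (Γ : Ctx G n) → Tm G S n → (τ : Ty G) → TreeHom (Γ.sem S) (τ.sem S) → Prop
  | var {n : ℕ} {Γ : Ctx G n} (i : Fin n) : Elab S Γ (.var i) (Γ i) (TreeHom.lookup S Γ i)
  | lam {n : ℕ} {Γ : Ctx G n} {t : Tm G S (n + 1)} {τ τ' : Ty G}
      {f : TreeHom ((Γ.ext τ).sem S) (τ'.sem S)} :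
      Elab S (Γ.ext τ) t τ' f → Elab S Γ (.lam τ t) (.arrow τ τ') (TreeHom.curry f)
  | app {n : ℕ} {Γ : Ctx G n} {t₁ t₂ : Tm G S n} {q : TimeWarp} {τ₁ τ₂ σ₁ σ₂ : Ty G}
      {f₁ : TreeHom (Γ.sem S) (τ₁.sem S)} {f₂ : TreeHom (Γ.sem S) (τ₂.sem S)}
      {c₁ : TreeHom (τ₁.sem S) ((Ty.arrow σ₁ σ₂).sem S)} {c₂ : TreeHom (τ₂.sem S) (σ₁.sem S)} :
      Elab S Γ t₁ τ₁ f₁ → Elab S Γ t₂ τ₂ f₂ → τ₁.normal = .warp q (.arrow σ₁ σ₂) →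
        Coh S τ₁ (.arrow σ₁ σ₂) c₁ → Coh S τ₂ σ₁ c₂ →
        Elab S Γ (.app t₁ t₂) σ₂ (TreeHom.apply (f₁.comp c₁) (f₂.comp c₂))
  | pair {n : ℕ} {Γ : Ctx G n} {t₁ t₂ : Tm G S n} {τ₁ τ₂ : Ty G}
      {f₁ : TreeHom (Γ.sem S) (τ₁.sem S)} {f₂ : TreeHom (Γ.sem S) (τ₂.sem S)} :
      Elab S Γ t₁ τ₁ f₁ → Elab S Γ t₂ τ₂ f₂ →
        Elab S Γ (.pair t₁ t₂) (.prod τ₁ τ₂) (TreeHom.pair f₁ f₂)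
  | proj₁ {n : ℕ} {Γ : Ctx G n} {t : Tm G S n} {τ σ₁ σ₂ : Ty G}
      {f : TreeHom (Γ.sem S) (τ.sem S)} {c : TreeHom (τ.sem S) ((Ty.prod σ₁ σ₂).sem S)} :
      Elab S Γ t τ f → τ.normal = .prod σ₁ σ₂ → Coh S τ (.prod σ₁ σ₂) c →
        Elab S Γ (.proj₁ t) σ₁ ((f.comp c).comp (TreeHom.fst _ _))
  | proj₂ {n : ℕ} {Γ : Ctx G n} {t : Tm G S n} {τ σ₁ σ₂ : Ty G}
      {f : TreeHom (Γ.sem S) (τ.sem S)} {c : TreeHom (τ.sem S) ((Ty.prod σ₁ σ₂).sem S)} :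
      Elab S Γ t τ f → τ.normal = .prod σ₁ σ₂ → Coh S τ (.prod σ₁ σ₂) c →
        Elab S Γ (.proj₂ t) σ₂ ((f.comp c).comp (TreeHom.snd _ _))
  | inj₁ {n : ℕ} {Γ : Ctx G n} {t : Tm G S n} {τ₁ τ₂ : Ty G}
      {f : TreeHom (Γ.sem S) (τ₁.sem S)} :
      Elab S Γ t τ₁ f →
        Elab S Γ (.inj₁ τ₂ t) (.sum τ₁ τ₂) (f.comp (TreeHom.inl _ (τ₂.sem S)))
  | inj₂ {n : ℕ} {Γ : Ctx G n} {t : Tm G S n} {τ₁ τ₂ : Ty G}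
      {f : TreeHom (Γ.sem S) (τ₂.sem S)} :
      Elab S Γ t τ₂ f →
        Elab S Γ (.inj₂ τ₁ t) (.sum τ₁ τ₂) (f.comp (TreeHom.inr (τ₁.sem S) _))
  | case {n : ℕ} {Γ : Ctx G n} {t : Tm G S n} {t₁ t₂ : Tm G S (n + 1)} {q : TimeWarp}
      {τ τ₁ τ₂ σ₁ σ₂ κ : Ty G} {f : TreeHom (Γ.sem S) (τ.sem S)}
      {c : TreeHom (τ.sem S) ((Ty.sum σ₁ σ₂).sem S)}
      {f₁ : TreeHom ((Γ.ext σ₁).sem S) (τ₁.sem S)} {f₂ : TreeHom ((Γ.ext σ₂).sem S) (τ₂.sem S)}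
      {c₁ : TreeHom (τ₁.sem S) (κ.sem S)} {c₂ : TreeHom (τ₂.sem S) (κ.sem S)} :
      Elab S Γ t τ f → τ.normal = .warp q (.sum σ₁ σ₂) → Coh S τ (.sum σ₁ σ₂) c →
        Elab S (Γ.ext σ₁) t₁ τ₁ f₁ → Elab S (Γ.ext σ₂) t₂ τ₂ f₂ → τ₁.sup? τ₂ = some κ →
        Coh S τ₁ κ c₁ → Coh S τ₂ κ c₂ →
        Elab S Γ (.case t t₁ t₂) κ (TreeHom.cases (f.comp c) (f₁.comp c₁) (f₂.comp c₂))
  | head {n : ℕ} {Γ : Ctx G n} {t : Tm G S n} {q : TimeWarp} {τ σ : Ty G}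
      {f : TreeHom (Γ.sem S) (τ.sem S)} {c : TreeHom (τ.sem S) ((Ty.stream σ).sem S)} :
      Elab S Γ t τ f → τ.normal = .warp q (.stream σ) → Coh S τ (.stream σ) c →
        Elab S Γ (.head t) σ ((f.comp c).comp (TreeHom.head _))
  | tail {n : ℕ} {Γ : Ctx G n} {t : Tm G S n} {q : TimeWarp} {τ σ : Ty G}
      {f : TreeHom (Γ.sem S) (τ.sem S)} {c : TreeHom (τ.sem S) ((Ty.stream σ).sem S)} :
      Elab S Γ t τ f → τ.normal = .warp q (.stream σ) → Coh S τ (.stream σ) c →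
        Elab S Γ (.tail t) (.warp TimeWarp.pred (.stream σ)) ((f.comp c).comp (TreeHom.tail _))
  | cons {n : ℕ} {Γ : Ctx G n} {t₁ t₂ : Tm G S n} {q : TimeWarp} {τ₁ τ₂ σ κ : Ty G}
      {f₁ : TreeHom (Γ.sem S) (τ₁.sem S)} {f₂ : TreeHom (Γ.sem S) (τ₂.sem S)}
      {c₁ : TreeHom (τ₁.sem S) (κ.sem S)}
      {c₂ : TreeHom (τ₂.sem S) ((Ty.warp TimeWarp.pred (.stream κ)).sem S)} :
      Elab S Γ t₁ τ₁ f₁ → Elab S Γ t₂ τ₂ f₂ → τ₂.normal = .warp q (.stream σ) →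
        τ₁.sup? σ = some κ → Coh S τ₁ κ c₁ → Coh S τ₂ (.warp TimeWarp.pred (.stream κ)) c₂ →
        Elab S Γ (.cons t₁ t₂) (.stream κ)
          ((TreeHom.pair (f₁.comp c₁) (f₂.comp c₂)).comp (TreeHom.cons _))
  | const {n : ℕ} {Γ : Ctx G n} (ν : G) (s : S ν) :
      Elab S Γ (.const ν s) (.ground ν) ⟨fun _ _ => s, fun _ _ => rfl⟩
  | fix {n : ℕ} {Γ : Ctx G n} {t : Tm G S (n + 1)} {τ τ' : Ty G}
      {f : TreeHom ((Γ.ext (.warp TimeWarp.pred τ)).sem S) (τ'.sem S)}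
      {c : TreeHom (τ'.sem S) (τ.sem S)} :
      Elab S (Γ.ext (.warp TimeWarp.pred τ)) t τ' f → Coh S τ' τ c →
        Elab S Γ (.fix τ t) τ (TreeHom.fix (f.comp c))
  | by_ {n : ℕ} {Γ : Ctx G n} {t : Tm G S n} {p : TimeWarp} {τ : Ty G}
      {f : TreeHom ((Γ.div p).sem S) (τ.sem S)}
      {c : ∀ i, TreeHom ((Γ i).sem S) (((Γ.div p).warp p i).sem S)} :
      Elab S (Γ.div p) t τ f → (∀ i, Coh S (Γ i) ((Γ.div p).warp p i) (c i)) →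
        Elab S Γ (.by_ t p) (.warp p τ)
          ((TreeHom.mapCtx c).comp ((TreeHom.warpCtx S p (Γ.div p)).comp (TreeHom.warpMap p f)))

theorem coerceCtx_eq {n : ℕ} {Γ Γ' : Ctx G n} {β : Fin n → Coercion}
    (h : ∀ i, coerce (Γ i) (Γ' i) = some (β i)) : coerceCtx Γ Γ' = some β := by
  have h' : ∀ i, (coerce (Γ i) (Γ' i)).isSome := fun i => by rw [h]; rfl
  rw [coerceCtx, dif_pos h']
  congr 1
  funext i
  simp [h]

namespace Elab

theorem sound {n : ℕ} {Γ : Ctx G n} {t : Tm G S n} {τ : Ty G} {f : TreeHom (Γ.sem S) (τ.sem S)}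
    (h : Elab S Γ t τ f) :
    ∃ e, elaborate Γ t = some (τ, e) ∧ e.erase = t ∧ ∃ d : Typing Γ e τ, d.sem = f := by
  induction h with
  | var i => exact ⟨_, rfl, rfl, .var i, rfl⟩
  | lam _ ih =>
    obtain ⟨e, h, h', d, rfl⟩ := ih
    exact ⟨_, by simp [elaborate, h], by simp [Tm.erase, h'], .lam d, rfl⟩
  | app _ _ hn hc₁ hc₂ ih₁ ih₂ =>
    obtain ⟨e₁, h₁, h₁', d₁, rfl⟩ := ih₁
    obtain ⟨e₂, h₂, h₂', d₂, rfl⟩ := ih₂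
    obtain ⟨α₁, ha₁, a₁, rfl⟩ := hc₁.coerce_eq
    obtain ⟨α₂, ha₂, a₂, rfl⟩ := hc₂.coerce_eq
    exact ⟨_, by simp [elaborate, h₁, h₂, hn, ha₁, ha₂], by simp [Tm.erase, h₁', h₂'],
      .app (.subR d₁ a₁) (.subR d₂ a₂), rfl⟩
  | pair _ _ ih₁ ih₂ =>
    obtain ⟨e₁, h₁, h₁', d₁, rfl⟩ := ih₁
    obtain ⟨e₂, h₂, h₂', d₂, rfl⟩ := ih₂
    exact ⟨_, by simp [elaborate, h₁, h₂], by simp [Tm.erase, h₁', h₂'], .pair d₁ d₂, rfl⟩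
  | proj₁ _ hn hc ih =>
    obtain ⟨e, h, h', d, rfl⟩ := ih
    obtain ⟨α, ha, a, rfl⟩ := hc.coerce_eq
    exact ⟨_, by simp [elaborate, h, hn, ha], by simp [Tm.erase, h'], .proj₁ (.subR d a), rfl⟩
  | proj₂ _ hn hc ih =>
    obtain ⟨e, h, h', d, rfl⟩ := ih
    obtain ⟨α, ha, a, rfl⟩ := hc.coerce_eq
    exact ⟨_, by simp [elaborate, h, hn, ha], by simp [Tm.erase, h'], .proj₂ (.subR d a), rfl⟩
  | inj₁ _ ih =>
    obtain ⟨e, h, h', d, rfl⟩ := ih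
    exact ⟨_, by simp [elaborate, h], by simp [Tm.erase, h'], .inj₁ d, rfl⟩
  | inj₂ _ ih =>
    obtain ⟨e, h, h', d, rfl⟩ := ih
    exact ⟨_, by simp [elaborate, h], by simp [Tm.erase, h'], .inj₂ d, rfl⟩
  | case _ hn hc _ _ hs hc₁ hc₂ ih ih₁ ih₂ =>
    obtain ⟨e, h, h', d, rfl⟩ := ih
    obtain ⟨e₁, h₁, h₁', d₁, rfl⟩ := ih₁
    obtain ⟨e₂, h₂, h₂', d₂, rfl⟩ := ih₂
    obtain ⟨α, ha, a, rfl⟩ := hc.coerce_eq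
    obtain ⟨α₁, ha₁, a₁, rfl⟩ := hc₁.coerce_eq
    obtain ⟨α₂, ha₂, a₂, rfl⟩ := hc₂.coerce_eq
    exact ⟨_, by simp [elaborate, h, h₁, h₂, hn, ha, hs, ha₁, ha₂],
      by simp [Tm.erase, h', h₁', h₂'], .case (.subR d a) (.subR d₁ a₁) (.subR d₂ a₂), rfl⟩
  | head _ hn hc ih =>
    obtain ⟨e, h, h', d, rfl⟩ := ih
    obtain ⟨α, ha, a, rfl⟩ := hc.coerce_eq
    exact ⟨_, by simp [elaborate, h, hn, ha], by simp [Tm.erase, h'], .head (.subR d a), rfl⟩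
  | tail _ hn hc ih =>
    obtain ⟨e, h, h', d, rfl⟩ := ih
    obtain ⟨α, ha, a, rfl⟩ := hc.coerce_eq
    exact ⟨_, by simp [elaborate, h, hn, ha], by simp [Tm.erase, h'], .tail (.subR d a), rfl⟩
  | cons _ _ hn hs hc₁ hc₂ ih₁ ih₂ =>
    obtain ⟨e₁, h₁, h₁', d₁, rfl⟩ := ih₁
    obtain ⟨e₂, h₂, h₂', d₂, rfl⟩ := ih₂
    obtain ⟨α₁, ha₁, a₁, rfl⟩ := hc₁.coerce_eq
    obtain ⟨α₂, ha₂, a₂, rfl⟩ := hc₂.coerce_eq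
    exact ⟨_, by simp [elaborate, h₁, h₂, hn, hs, ha₁, ha₂], by simp [Tm.erase, h₁', h₂'],
      .cons (.subR d₁ a₁) (.subR d₂ a₂), rfl⟩
  | const ν s => exact ⟨_, rfl, rfl, .const ν s, rfl⟩
  | fix _ hc ih =>
    obtain ⟨e, h, h', d, rfl⟩ := ih
    obtain ⟨α, ha, a, rfl⟩ := hc.coerce_eq
    exact ⟨_, by simp [elaborate, h, ha], by simp [Tm.erase, h'], .fix (.subR d a), rfl⟩
  | by_ _ hc ih =>
    obtain ⟨e, h, h', d, rfl⟩ := ih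
    choose β hβ b hb using fun i => (hc i).coerce_eq
    obtain rfl := funext hb
    exact ⟨_, by simp [elaborate, h, coerceCtx_eq hβ], by simp [Tm.erase, h', Tm.rename_id],
      .subL b (.by_ _ d), rfl⟩

/-- Determinism is inherited from the function `elaborate`, rather than proved by comparing rules.
-/
theorem type_unique {n : ℕ} {Γ : Ctx G n} {t : Tm G S n} {τ τ' : Ty G}
    {f : TreeHom (Γ.sem S) (τ.sem S)} {f' : TreeHom (Γ.sem S) (τ'.sem S)}
    (h : Elab S Γ t τ f) (h' : Elab S Γ t τ' f') : τ = τ' := by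
  obtain ⟨e, he, -⟩ := h.sound
  obtain ⟨e', he', -⟩ := h'.sound
  rw [he, Option.some_inj, Prod.mk.injEq] at he'
  exact he'.1

/-- The morphisms in each rule are determined by the premises, the coercions among them by
coherence. Equality is heterogeneous because the types agree only through `type_unique`. -/
theorem unique {n : ℕ} {Γ : Ctx G n} {t : Tm G S n} {τ τ' : Ty G}
    {f : TreeHom (Γ.sem S) (τ.sem S)} {f' : TreeHom (Γ.sem S) (τ'.sem S)}
    (h : Elab S Γ t τ f) (h' : Elab S Γ t τ' f') : HEq f f' := by
  induction h generalizing τ' with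
  | var i => cases h'; rfl
  | lam h ih =>
    cases h' with | lam h' =>
    obtain rfl := h.type_unique h'
    obtain rfl := eq_of_heq (ih h')
    rfl
  | app h₁ h₂ hn hc₁ hc₂ ih₁ ih₂ =>
    cases h' with | app h₁' h₂' hn' hc₁' hc₂' =>
    obtain rfl := h₁.type_unique h₁'
    obtain rfl := h₂.type_unique h₂'
    obtain rfl := eq_of_heq (ih₁ h₁')
    obtain rfl := eq_of_heq (ih₂ h₂')
    rw [hn] at hn'
    cases hn'
    rw [hc₁.unique hc₁', hc₂.unique hc₂']
  | pair h₁ h₂ ih₁ ih₂ =>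
    cases h' with | pair h₁' h₂' =>
    obtain rfl := h₁.type_unique h₁'
    obtain rfl := h₂.type_unique h₂'
    obtain rfl := eq_of_heq (ih₁ h₁')
    obtain rfl := eq_of_heq (ih₂ h₂')
    rfl
  | proj₁ h hn hc ih =>
    cases h' with | proj₁ h' hn' hc' =>
    obtain rfl := h.type_unique h'
    obtain rfl := eq_of_heq (ih h')
    rw [hn] at hn'
    cases hn'
    rw [hc.unique hc']
  | proj₂ h hn hc ih =>
    cases h' with | proj₂ h' hn' hc' =>
    obtain rfl := h.type_unique h'
    obtain rfl := eq_of_heq (ih h')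
    rw [hn] at hn'
    cases hn'
    rw [hc.unique hc']
  | inj₁ h ih =>
    cases h' with | inj₁ h' =>
    obtain rfl := h.type_unique h'
    obtain rfl := eq_of_heq (ih h')
    rfl
  | inj₂ h ih =>
    cases h' with | inj₂ h' =>
    obtain rfl := h.type_unique h'
    obtain rfl := eq_of_heq (ih h')
    rfl
  | case h hn hc h₁ h₂ hs hc₁ hc₂ ih ih₁ ih₂ =>
    cases h' with | case h' hn' hc' h₁' h₂' hs' hc₁' hc₂' =>
    obtain rfl := h.type_unique h'
    obtain rfl := eq_of_heq (ih h')
    rw [hn] at hn'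
    cases hn'
    obtain rfl := h₁.type_unique h₁'
    obtain rfl := h₂.type_unique h₂'
    obtain rfl := eq_of_heq (ih₁ h₁')
    obtain rfl := eq_of_heq (ih₂ h₂')
    rw [hs] at hs'
    cases hs'
    rw [hc.unique hc', hc₁.unique hc₁', hc₂.unique hc₂']
  | head h hn hc ih =>
    cases h' with | head h' hn' hc' =>
    obtain rfl := h.type_unique h'
    obtain rfl := eq_of_heq (ih h')
    rw [hn] at hn'
    cases hn'
    rw [hc.unique hc']
  | tail h hn hc ih =>
    cases h' with | tail h' hn' hc' =>
    obtain rfl := h.type_unique h'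
    obtain rfl := eq_of_heq (ih h')
    rw [hn] at hn'
    cases hn'
    rw [hc.unique hc']
  | cons h₁ h₂ hn hs hc₁ hc₂ ih₁ ih₂ =>
    cases h' with | cons h₁' h₂' hn' hs' hc₁' hc₂' =>
    obtain rfl := h₁.type_unique h₁'
    obtain rfl := h₂.type_unique h₂'
    obtain rfl := eq_of_heq (ih₁ h₁')
    obtain rfl := eq_of_heq (ih₂ h₂')
    rw [hn] at hn'
    cases hn'
    rw [hs] at hs'
    cases hs'
    rw [hc₁.unique hc₁', hc₂.unique hc₂']
  | const ν s => cases h'; rfl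
  | fix h hc ih =>
    cases h' with | fix h' hc' =>
    obtain rfl := h.type_unique h'
    obtain rfl := eq_of_heq (ih h')
    rw [hc.unique hc']
  | by_ h hc ih =>
    cases h' with | by_ h' hc' =>
    obtain rfl := h.type_unique h'
    obtain rfl := eq_of_heq (ih h')
    obtain rfl := funext fun i => (hc i).unique (hc' i)
    rfl

end Elab

/-! ### Environments -/

/-- The morphism of environments given by a map of variables and coercions for each of them. -/
def envHom {n m : ℕ} {Γ : Ctx G n} {Γ' : Ctx G m} (σ : Fin n → Fin m)
    (g : ∀ i, TreeHom ((Γ' (σ i)).sem S) ((Γ i).sem S)) : TreeHom (Γ'.sem S) (Γ.sem S) :=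
  (TreeHom.reindex S Γ' σ).comp (TreeHom.mapCtx g)

/-- Extension of a family of coercions under a binder. -/
def extCoe {n m : ℕ} {Γ : Ctx G n} {Γ' : Ctx G m} {σ : Fin n → Fin m} {τ τ' : Ty G}
    (x : TreeHom (τ'.sem S) (τ.sem S)) (g : ∀ i, TreeHom ((Γ' (σ i)).sem S) ((Γ i).sem S)) :
    ∀ i, TreeHom ((Γ'.ext τ' (liftVar σ i)).sem S) ((Γ.ext τ i).sem S) :=
  fun i => Fin.cases
    (motive := fun i => TreeHom ((Γ'.ext τ' (liftVar σ i)).sem S) ((Γ.ext τ i).sem S)) x g i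

section

variable {n m : ℕ} {Γ : Ctx G n} {Γ' : Ctx G m} {σ : Fin n → Fin m} {τ τ' : Ty G}
  {g : ∀ i, TreeHom ((Γ' (σ i)).sem S) ((Γ i).sem S)}

theorem coh_extCoe {x : TreeHom (τ'.sem S) (τ.sem S)} (hx : Coh S τ' τ x)
    (hg : ∀ i, Coh S (Γ' (σ i)) (Γ i) (g i)) (i : Fin (n + 1)) :
    Coh S (Γ'.ext τ' (liftVar σ i)) (Γ.ext τ i) (extCoe x g i) := by
  refine Fin.cases hx (fun j => hg j) i

theorem envHom_extEnv (x : TreeHom (τ'.sem S) (τ.sem S)) (k : ℕ) (γ : (Γ'.sem S).obj k)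
    (y : (τ'.sem S).obj k) :
    (envHom (Γ := Γ.ext τ) (Γ' := Γ'.ext τ') (liftVar σ) (extCoe x g)).app k (extEnv γ y) =
      extEnv ((envHom σ g).app k γ) (x.app k y) := by
  funext i
  refine Fin.cases rfl (fun j => rfl) i

theorem envHom_curry {Y : TreeObj.{v}} (f : TreeHom ((Γ.ext τ).sem S) Y) :
    (envHom σ g).comp (TreeHom.curry f) =
      TreeHom.curry ((envHom (Γ' := Γ'.ext τ) (liftVar σ) (extCoe (TreeHom.id _) g)).comp f) := by
  refine TreeHom.ext_app fun k γ => Subtype.ext <| funext fun l => funext fun hl =>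
    funext fun y => ?_
  show f.app l (extEnv ((Γ.sem S).res hl ((envHom σ g).app k γ)) y) =
    f.app l ((envHom (liftVar σ) (extCoe (TreeHom.id _) g)).app l
      (extEnv ((Γ'.sem S).res hl γ) y))
  rw [envHom_extEnv, (envHom σ g).nat]
  rfl

/-- The scrutinee may elaborate to a smaller sum than in the derivation; the bound variable of each
branch is then coerced along the corresponding component of the sum morphism. -/
theorem envHom_cases {τ₁ τ₂ σ₁ σ₂ : Ty G} {Y : TreeObj.{v}}
    {f : TreeHom (Γ.sem S) (TreeObj.sum (τ₁.sem S) (τ₂.sem S))}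
    {f' : TreeHom (Γ'.sem S) (TreeObj.sum (σ₁.sem S) (σ₂.sem S))}
    {x₁ : TreeHom (σ₁.sem S) (τ₁.sem S)} {x₂ : TreeHom (σ₂.sem S) (τ₂.sem S)}
    (h : (envHom σ g).comp f = f'.comp (TreeHom.sumMap x₁ x₂))
    (f₁ : TreeHom ((Γ.ext τ₁).sem S) Y) (f₂ : TreeHom ((Γ.ext τ₂).sem S) Y) :
    (envHom σ g).comp (TreeHom.cases f f₁ f₂) =
      TreeHom.cases f' ((envHom (Γ' := Γ'.ext σ₁) (liftVar σ) (extCoe x₁ g)).comp f₁)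
        ((envHom (Γ' := Γ'.ext σ₂) (liftVar σ) (extCoe x₂ g)).comp f₂) := by
  refine TreeHom.ext_app fun k γ => ?_
  have e := TreeHom.congr_app h γ
  simp only [TreeHom.comp] at e
  simp only [TreeHom.comp, TreeHom.cases, e]
  rcases f'.app k γ with y | y
  · exact congrArg (f₁.app k) (envHom_extEnv x₁ k γ y).symm
  · exact congrArg (f₂.app k) (envHom_extEnv x₂ k γ y).symm

/-- Induction on the time step: the value at `k + 1` uses the fixpoint at `k` in the restricted
environment, and restriction commutes with `envHom`. -/
theorem envHom_fix (f : TreeHom ((Γ.ext (.warp TimeWarp.pred τ)).sem S) (τ.sem S)) :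
    (envHom σ g).comp (TreeHom.fix f) =
      TreeHom.fix ((envHom (Γ' := Γ'.ext (.warp TimeWarp.pred τ)) (liftVar σ)
        (extCoe (TreeHom.id _) g)).comp f) := by
  refine TreeHom.ext_app fun k => ?_
  induction k with
  | zero =>
    intro γ
    exact congrArg (f.app 0) (envHom_extEnv (τ := .warp TimeWarp.pred τ)
      (τ' := .warp TimeWarp.pred τ) (TreeHom.id _) 0 γ _).symm
  | succ k ih =>
    intro γ
    refine Eq.trans ?_ (congrArg (f.app (k + 1)) (envHom_extEnv (τ := .warp TimeWarp.pred τ)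
      (τ' := .warp TimeWarp.pred τ) (TreeHom.id _) (k + 1) γ _).symm)
    refine congrArg (fun z => f.app (k + 1) (extEnv (τ := .warp TimeWarp.pred τ) _ z)) ?_
    apply Subtype.ext
    funext l hl
    refine congrArg ((τ.sem S).res _) (Eq.trans ?_ (ih ((Γ'.sem S).res (Nat.le_succ k) γ)))
    exact congrArg (TreeHom.fixApp f k) ((envHom σ g).nat (Nat.le_succ k) γ).symm

end

/-! ### Completeness -/

/-- Completeness of elaboration, in any context that is coerced to the given one after a renaming. -/
theorem Typing.exists_elaboration {n : ℕ} {Γ : Ctx G n} {e : Tm G S n} {τ : Ty G} (d : Typing Γ e τ) :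
    ∀ {m : ℕ} (σ : Fin n → Fin m) (Γ' : Ctx G m)
      (g : ∀ i, TreeHom ((Γ' (σ i)).sem S) ((Γ i).sem S)),
      (∀ i, Coh S (Γ' (σ i)) (Γ i) (g i)) →
      ∃ τm f c, Elab S Γ' (e.erase.rename σ) τm f ∧ Coh S τm τ c ∧
        (envHom σ g).comp d.sem = f.comp c := by
  induction d with
  | var i =>
    intro m σ Γ' g hg
    exact ⟨_, _, _, .var (σ i), hg i, rfl⟩
  | lam d ih =>
    intro m σ Γ' g hg
    -- Binders of functions are annotated, so the bound variable has the same type in both contexts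
    -- and is coerced by the identity.
    obtain ⟨_, f, c, h, hc, e⟩ := ih (liftVar σ) (Γ'.ext _) _ (coh_extCoe (.refl S _) hg)
    refine ⟨_, _, _, .lam h, (Coh.refl S _).arrow hc, ?_⟩
    refine (envHom_curry _).trans ?_
    rw [e]
    rfl
  | app d₁ d₂ ih₁ ih₂ =>
    intro m σ Γ' g hg
    obtain ⟨_, f₁, c₁, h₁, hc₁, e₁⟩ := ih₁ σ Γ' g hg
    obtain ⟨_, f₂, c₂, h₂, hc₂, e₂⟩ := ih₂ σ Γ' g hg
    obtain ⟨q, σ₁, σ₂, hn, c, x, y, hc, hx, hy, rfl⟩ := hc₁.arrow_inv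
    refine ⟨_, _, _, .app h₁ h₂ hn hc (hc₂.trans hx), hy, ?_⟩
    exact congrArg₂ (fun a b => TreeHom.apply a b) e₁ e₂
  | pair d₁ d₂ ih₁ ih₂ =>
    intro m σ Γ' g hg
    obtain ⟨_, f₁, c₁, h₁, hc₁, e₁⟩ := ih₁ σ Γ' g hg
    obtain ⟨_, f₂, c₂, h₂, hc₂, e₂⟩ := ih₂ σ Γ' g hg
    refine ⟨_, _, _, .pair h₁ h₂, hc₁.prod hc₂, ?_⟩
    exact congrArg₂ (fun a b => TreeHom.pair a b) e₁ e₂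
  | proj₁ d ih =>
    intro m σ Γ' g hg
    obtain ⟨_, f, c, h, hc, e⟩ := ih σ Γ' g hg
    obtain ⟨σ₁, σ₂, hn, c, x, y, hc', hx, hy, rfl⟩ := hc.prod_inv
    refine ⟨_, _, _, .proj₁ h hn hc', hx, ?_⟩
    exact congrArg (fun a => TreeHom.comp a (TreeHom.fst _ _)) e
  | proj₂ d ih =>
    intro m σ Γ' g hg
    obtain ⟨_, f, c, h, hc, e⟩ := ih σ Γ' g hg
    obtain ⟨σ₁, σ₂, hn, c, x, y, hc', hx, hy, rfl⟩ := hc.prod_inv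
    refine ⟨_, _, _, .proj₂ h hn hc', hy, ?_⟩
    exact congrArg (fun a => TreeHom.comp a (TreeHom.snd _ _)) e
  | inj₁ d ih =>
    intro m σ Γ' g hg
    obtain ⟨_, f, c, h, hc, e⟩ := ih σ Γ' g hg
    refine ⟨_, _, _, .inj₁ h, hc.sum (.refl S _), ?_⟩
    exact congrArg (fun a => TreeHom.comp a (TreeHom.inl _ _)) e
  | inj₂ d ih =>
    intro m σ Γ' g hg
    obtain ⟨_, f, c, h, hc, e⟩ := ih σ Γ' g hg
    refine ⟨_, _, _, .inj₂ h, (Coh.refl S _).sum hc, ?_⟩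
    exact congrArg (fun a => TreeHom.comp a (TreeHom.inr _ _)) e
  | case d d₁ d₂ ih ih₁ ih₂ =>
    intro m σ Γ' g hg
    obtain ⟨_, f, c, h, hc, e⟩ := ih σ Γ' g hg
    obtain ⟨q, σ₁, σ₂, hn, c, x, y, hc', hx, hy, rfl⟩ := hc.sum_inv
    -- The branches are elaborated with bound variables of the types found in the normal form of the
    -- scrutinee, which `hx` and `hy` coerce to those of the derivation.
    obtain ⟨_, f₁, c₁, h₁, hc₁, e₁⟩ := ih₁ (liftVar σ) (Γ'.ext σ₁) _ (coh_extCoe hx hg)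
    obtain ⟨_, f₂, c₂, h₂, hc₂, e₂⟩ := ih₂ (liftVar σ) (Γ'.ext σ₂) _ (coh_extCoe hy hg)
    obtain ⟨κ, k₁, k₂, k, hs, hk₁, hk₂, hk, rfl, rfl⟩ := hc₁.exists_sup hc₂
    refine ⟨_, _, _, .case h hn hc' h₁ h₂ hs hk₁ hk₂, hk, ?_⟩
    refine (envHom_cases (f' := f.comp c) e _ _).trans ?_
    rw [e₁, e₂]
    refine TreeHom.ext_app fun l γ => ?_
    simp only [TreeHom.comp, TreeHom.cases]
    rcases c.app l (f.app l γ) with z | z <;> rfl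
  | head d ih =>
    intro m σ Γ' g hg
    obtain ⟨_, f, c, h, hc, e⟩ := ih σ Γ' g hg
    obtain ⟨q, σ₁, hn, c, x, hc', hx, rfl⟩ := hc.stream_inv
    refine ⟨_, _, _, .head h hn hc', hx, ?_⟩
    exact congrArg (fun a => TreeHom.comp a (TreeHom.head _)) e
  | tail d ih =>
    intro m σ Γ' g hg
    obtain ⟨_, f, c, h, hc, e⟩ := ih σ Γ' g hg
    obtain ⟨q, σ₁, hn, c, x, hc', hx, rfl⟩ := hc.stream_inv
    refine ⟨_, _, _, .tail h hn hc', hx.stream.warp _, ?_⟩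
    refine (congrArg (fun a => TreeHom.comp a (TreeHom.tail _)) e).trans ?_
    refine TreeHom.ext_app fun l γ => Subtype.ext <| funext fun j => funext fun hj =>
      funext fun k => funext fun hk => ?_
    -- The tail restricts the elements of the stream to earlier steps, and `x` commutes with
    -- restriction.
    exact (x.nat _ _).symm
  | cons d₁ d₂ ih₁ ih₂ =>
    intro m σ Γ' g hg
    obtain ⟨_, f₁, c₁, h₁, hc₁, e₁⟩ := ih₁ σ Γ' g hg
    obtain ⟨_, f₂, c₂, h₂, hc₂, e₂⟩ := ih₂ σ Γ' g hg
    obtain ⟨q, σ₁, hn, c, x, hc, hx, rfl⟩ := hc₂.warp_stream_inv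
    obtain ⟨κ, k₁, k₂, k, hs, hk₁, hk₂, hk, rfl, rfl⟩ := hc₁.exists_sup hx
    refine ⟨_, _, _, .cons h₁ h₂ hn hs hk₁ (hc.trans (hk₂.stream.warp _)), hk.stream, ?_⟩
    refine (congrArg₂ (fun a b => (TreeHom.pair a b).comp (TreeHom.cons _)) e₁ e₂).trans ?_
    refine TreeHom.ext_app fun l γ => funext fun j => funext fun hj => ?_
    cases j with
    | zero => rfl
    | succ j => exact (k.nat _ _).symm
  | const ν s =>
    intro m σ Γ' g hg
    exact ⟨_, _, _, .const ν s, .refl S _, rfl⟩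
  | fix d ih =>
    intro m σ Γ' g hg
    obtain ⟨_, f, c, h, hc, e⟩ := ih (liftVar σ) (Γ'.ext _) _ (coh_extCoe (.refl S _) hg)
    refine ⟨_, _, _, .fix h hc, .refl S _, ?_⟩
    refine (envHom_fix _).trans ?_
    rw [e]
    rfl
  | by_ p d ih =>
    intro m σ Γ' g hg
    choose b hb using fun i => Coh.exists_div S p (Γ' i)
    choose g' hg' using fun i => (hg i).div_inv
    obtain ⟨_, f, c, h, hc, e⟩ := ih σ (Γ'.div p) g' hg'
    -- The context coercion factors through the division: first `b`, inserted by elaboration, then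
    -- the warping of `g'`, used in the induction hypothesis.
    obtain rfl : g = fun i => (b (σ i)).comp (TreeHom.warpMap p (g' i)) :=
      funext fun i => (hg i).unique ((hb (σ i)).trans ((hg' i).warp p))
    refine ⟨_, _, _, .by_ h hb, hc.warp p, ?_⟩
    exact TreeHom.ext_app fun l γ => Subtype.ext <| funext fun j => funext fun hj =>
      TreeHom.congr_app e fun i => ((b i).app l (γ i)).1 j hj
  | subR d a ih =>
    intro m σ Γ' g hg
    obtain ⟨_, f, c, h, hc, e⟩ := ih σ Γ' g hg
    refine ⟨_, _, _, h, hc.trans (a.coh S), ?_⟩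
    exact congrArg (fun z => TreeHom.comp z (a.sem S)) e
  | subL b d ih =>
    intro m σ Γ' g hg
    -- The context coercion disappears from the term and is absorbed in the coercion of
    -- environments.
    obtain ⟨_, f, c, h, hc, e⟩ := ih σ Γ' _ fun i => (hg i).trans ((b i).coh S)
    refine ⟨_, f, c, ?_, hc, e⟩
    rwa [Tm.erase, Tm.rename_id]
  | struct σ' d ih =>
    intro m σ Γ' g hg
    obtain ⟨_, f, c, h, hc, e⟩ := ih (fun i => σ (σ' i)) Γ' (fun i => g (σ' i))
      fun i => hg (σ' i)
    refine ⟨_, f, c, ?_, hc, e⟩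
    rwa [Tm.erase_rename, Tm.rename_rename]

theorem Typing.exists_elaboration_self {n : ℕ} {Γ : Ctx G n} {e : Tm G S n} {τ : Ty G}
    (d : Typing Γ e τ) :
    ∃ τm f c, Elab S Γ e.erase τm f ∧ Coh S τm τ c ∧ d.sem = f.comp c := by
  have h := d.exists_elaboration (fun i => i) Γ (fun _ => TreeHom.id _) fun i => .refl S _
  rwa [Tm.rename_id] at h

/-- Coherence of typing: the interpretation of a derivation depends only on the context, the type
and the erasure of the term. -/
theorem Typing.coherence {n : ℕ} {Γ : Ctx G n} {e e' : Tm G S n} {τ : Ty G}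
    (he : e.erase = e'.erase) (d : Typing Γ e τ) (d' : Typing Γ e' τ) : d.sem = d'.sem := by
  obtain ⟨_, f, c, h, hc, hd⟩ := d.exists_elaboration_self
  obtain ⟨_, f', c', h', hc', hd'⟩ := d'.exists_elaboration_self
  rw [← he] at h'
  obtain rfl := h.type_unique h'
  rw [hd, hd', eq_of_heq (h.unique h'), hc.unique hc']

end WarpCalc

theorem mainTheorem1 {G : Type u} {S : G → Type v} {n : ℕ}
    (Γ : Ctx G n) (e : Tm G S n) (τ : Ty G) (he : HasType Γ e τ) :
    ∃ (τm : Ty G) (em : Tm G S n) (αm : Coercion),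
      elaborate Γ e.erase = some (τm, em) ∧
      HasType Γ em τm ∧
      HasSub αm τm τ ∧
      SemEq Γ e (.coeR em αm) τ := by
  obtain ⟨d⟩ := he
  -- The factorization for the derivation `d` is dropped: the two terms have the same erasure, so
  -- coherence of typing covers every pair of derivations.
  obtain ⟨τm, f, c, h, hc, -⟩ := d.exists_elaboration_self
  obtain ⟨em, hem, her, dm, -⟩ := h.sound
  obtain ⟨αm, -, a, -⟩ := hc.coerce_eq
  exact ⟨τm, em, αm, hem, ⟨dm⟩, ⟨a⟩, ⟨d⟩, ⟨.subR dm a⟩,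
    fun d₁ d₂ => d₁.coherence (by rw [Tm.erase, her]) d₂⟩
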